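/- Let $n\ge 3$, $\lambda>0$ and $\Lambda,\rho,V\in\mathbb R$. There is a constant $C\ge 0$, depending only on $n,\lambda,\Lambda,\rho,V$, with the following property. Let $\Omega\subset\mathbb R^n$ be a domain (open, connected) with $|\Omega|\le V$. Let $\mathbf A$ be a measurable $n\times n$ matrix field on $\Omega$ with $\|\mathbf A\|_{L^\infty(\Omega)}\le\Lambda$ (Euclidean operator norm) and $\mathbf A(x)\xi\cdot\xi\ge\lambda|\xi|^2$ for a.e. $x\in\Omega$ and all $\xi\in\mathbb R^n$. Let $\vec b,\vec c\in L^n(\Omega)^n$ and $d\in L^{n/2}(\Omega)$, and suppose that $d\ge\operatorname{div}\vec b$ in $\Omega$ or $d\ge\operatorname{div}\vec c$ in $\Omega$, in the sense of distributions. Suppose that $$r_{\vec b-\vec c}\Big(\frac{\lambda}{3C_n}\Big)\le\rho,\qquad r_f(\varepsilon):=\inf\big\{t>0:\ \|f\,\mathbf 1_{\{|f|\ge t\}}\|_{L^n(\Omega)}<\varepsilon\big\},$$ where $C_n$ is the best constant in the Sobolev inequality $\|\varphi\|_{L^{2n/(n-2)}(\mathbb R^n)}\le C_n\|\nabla\varphi\|_{L^2(\mathbb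 R^n)}$, $\varphi\in C_c^\infty(\mathbb R^n)$. Let $x_0\in\Omega$ and $1\le q<\frac n{n-1}$, and let $u\in W^{1,q}_0(\Omega)$ satisfy $u\in W^{1,2}(\Omega\setminus \overline{B_s(x_0)})$ for every $s>0$. Suppose moreover that $u$ vanishes on $\partial\Omega$ in the $W^{1,2}$ sense away from $x_0$, that is, for every $s>0$ there is $w\in W^{1,2}_0(\Omega)$ with $w=u$ a.e. in $\Omega\setminus \overline{B_s(x_0)}$. Suppose that $u$ solves $$-\operatorname{div}(\mathbf A\nabla u+\vec b\,u)+\vec c\cdot\nabla u+d\,u=0\quad\text{in }\Omega\setminus\{x_0\}$$ weakly, that is, for all $\varphi\in C_c^\infty(\Omega\setminus\{x_0\})$, $$\int_\Omega \mathbf A\nabla u\cdot\nabla\varphi+\vec b\cdot\nabla\varphi\,u+\vec c\cdot\nabla u\,\varphi+d\,u\,\varphi=0.$$ If $\|u\|_{L^{\frac n{n-2},\infty}(\Omega)}<\infty$, where $\|f\|_{L^{p,\infty}(\Omega)}=\sup_{t>0}t\,|\{x\in\Omega:|f(x)|>t\}|^{1/p}$, then $$\|\nabla u\|_{L^{\frac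 n{n-1},\infty}(\Omega)}\le C\,\|u\|^2_{L^{\frac n{n-2},\infty}(\Omega)}+C.$$ -/

import Mathlib

open MeasureTheory Filter Topology
open scoped ENNReal NNReal ContDiff

noncomputable section

/-- Euclidean space `ℝⁿ`. -/
abbrev Rn (n : ℕ) : Type := EuclideanSpace ℝ (Fin n)

/-- `φ ∈ C_c^∞(U)`. -/
def IsTestFunction {n : ℕ} (U : Set (Rn n)) (φ : Rn n → ℝ) : Prop :=
  ContDiff ℝ ∞ φ ∧ HasCompactSupport φ ∧ tsupport φ ⊆ U

/-- `g` is the weak (distributional) gradient of `u` in the open set `U`. -/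
def HasWeakGradient {n : ℕ} (U : Set (Rn n)) (u : Rn n → ℝ) (g : Rn n → Rn n) : Prop :=
  LocallyIntegrableOn u U volume ∧ LocallyIntegrableOn g U volume ∧
    ∀ φ : Rn n → ℝ, IsTestFunction U φ →
      ∫ x in U, u x • gradient φ x = - ∫ x in U, φ x • g x

/-- `u ∈ W^{1,p}(U)`, with weak gradient `g`. -/
def MemW1p {n : ℕ} (U : Set (Rn n)) (p : ℝ≥0∞) (u : Rn n → ℝ) (g : Rn n → Rn n) : Prop :=
  MemLp u p (volume.restrict U) ∧ MemLp g p (volume.restrict U) ∧ HasWeakGradient U u g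

/-- `u ∈ W_0^{1,p}(U)`, with weak gradient `g`: `u` belongs to the closure of `C_c^∞(U)` in
`W^{1,p}(U)`. -/
def MemW01p {n : ℕ} (U : Set (Rn n)) (p : ℝ≥0∞) (u : Rn n → ℝ) (g : Rn n → Rn n) : Prop :=
  MemW1p U p u g ∧
    ∃ φ : ℕ → Rn n → ℝ, (∀ k, IsTestFunction U (φ k)) ∧
      Tendsto (fun k => eLpNorm (fun x => u x - φ k x) p (volume.restrict U)) atTop (𝓝 0) ∧
      Tendsto (fun k => eLpNorm (fun x => g x - gradient (φ k) x) p (volume.restrict U))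
        atTop (𝓝 0)

/-- The Lorentz (weak Lebesgue) quasinorm of `L^{p,∞}(U)`:
`sup_{t>0} t |{x ∈ U : |f(x)| > t}|^{1/p}`. -/
def weakLpNorm {n : ℕ} {F : Type*} [NormedAddCommGroup F]
    (U : Set (Rn n)) (p : ℝ) (f : Rn n → F) : ℝ≥0∞ :=
  ⨆ t : ℝ≥0, (t : ℝ≥0∞) * (volume.restrict U {x | (t : ℝ≥0∞) < ‖f x‖ₑ}) ^ (1 / p)

/-- The Sobolev constant `C_n`: the least `C ≥ 0` such that
`‖φ‖_{2n/(n-2)} ≤ C ‖∇φ‖_2` for all `φ ∈ C_c^∞(ℝⁿ)`. -/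
def sobolevConst (n : ℕ) : ℝ :=
  sInf {C : ℝ | 0 ≤ C ∧ ∀ φ : Rn n → ℝ, IsTestFunction Set.univ φ →
    eLpNorm φ (ENNReal.ofReal (2 * (n : ℝ) / ((n : ℝ) - 2))) volume ≤
      ENNReal.ofReal C * eLpNorm (gradient φ) 2 volume}

/-- `R_f(t) = ‖ |f|^{(t)} ‖_{L^n(U)}`, where `|f|^{(t)} = |f|` on `{|f| ≥ t}` and `0` elsewhere. -/
def upperTail {n : ℕ} (U : Set (Rn n)) (f : Rn n → Rn n) (t : ℝ) : ℝ≥0∞ :=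
  eLpNorm (Set.indicator {x | t ≤ ‖f x‖} f) (n : ℝ≥0∞) (volume.restrict U)

/-- `r_f(ε) = inf {t > 0 : R_f(t) < ε}`. -/
def tailLevel {n : ℕ} (U : Set (Rn n)) (f : Rn n → Rn n) (ε : ℝ) : ℝ :=
  sInf {t : ℝ | 0 < t ∧ upperTail U f t < ENNReal.ofReal ε}

/-- `d ≥ div b` in `U` in the sense of distributions. -/
def GeDiv {n : ℕ} (U : Set (Rn n)) (d : Rn n → ℝ) (b : Rn n → Rn n) : Prop :=
  ∀ φ : Rn n → ℝ, IsTestFunction U φ → (∀ x, 0 ≤ φ x) →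
    0 ≤ ∫ x in U, (inner ℝ (b x) (gradient φ x) + d x * φ x)

/-- `u`, with weak gradient `Du`, satisfies `-div (A ∇u + b u) + c · ∇u + d u = 0` weakly in the
open set `U`. The matrix field `A` is a field of linear maps. -/
def IsWeakSolution {n : ℕ} (U : Set (Rn n)) (A : Rn n → Rn n →L[ℝ] Rn n) (b c : Rn n → Rn n)
    (d : Rn n → ℝ) (u : Rn n → ℝ) (Du : Rn n → Rn n) : Prop :=
  ∀ φ : Rn n → ℝ, IsTestFunction U φ →
    ∫ x in U, (inner ℝ (A x (Du x)) (gradient φ x) + inner ℝ (b x) (gradient φ x) * u x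
      + inner ℝ (c x) (Du x) * φ x + d x * u x * φ x) = 0

/-- `u = 0` on `∂U` in the `W^{1,2}` sense, away from the point `x₀`: outside every ball centred
at `x₀`, `u` coincides with an element of `W_0^{1,2}(U)`. -/
def VanishesOnBoundaryAwayFrom {n : ℕ} (U : Set (Rn n)) (x₀ : Rn n) (u : Rn n → ℝ) : Prop :=
  ∀ s : ℝ, 0 < s → ∃ (w : Rn n → ℝ) (Dw : Rn n → Rn n), MemW01p U 2 w Dw ∧
    ∀ᵐ x ∂(volume.restrict (U \ Metric.closedBall x₀ s)), w x = u x

end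

/-! ### Gradients of smooth functions -/

/-! The model is the fundamental solution: `|x|^(2-n)` lies in weak `L^(n/(n-2))`, its gradient in
weak `L^(n/(n-1))`, and the energy of that gradient off a ball of radius `r` is of order `r^(2-n)`.
The heart of the proof is the same decay for `u`: if its weak norm is at most `N`, then the energy
of `Du` off the ball of radius `2r` is at most `C N² r^(2-n)` for `r ≤ 1` (`exists_energy_decay`).
Chebyshev's inequality outside the ball, the trivial volume bound inside, and the choice `r^(n-1) =
N/s` then control the set where `|Du| > s`.

The decay starts from a Caccioppoli inequality (`caccioppoli`). Outside the ball of radius `r`, `u`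
agrees with some `w` in `W_0^{1,2}`, and the equation is tested with `ζ² w`, where the cut-off `ζ`
vanishes near the pole. The sign condition `d ≥ div b` or `d ≥ div c`, tested with `(ζ w)²`, removes
`d` and leaves only the drift `b - c`. Where `|b - c|` is large, its `L^n` norm is below `λ/(3
C_n)`, and Sobolev's inequality absorbs that part into the ellipticity term; elsewhere `|b - c|` is
bounded in terms of `ρ`.

What remains on the right are the `L²` norms of `w ∇ζ` and `ζ w`. Both are interpolated between the
Sobolev norm of `ζ w` and an `L¹` norm of `u`, the latter being controlled by the weak norm. The
Sobolev norm enters with a power below two, and is itself bounded by the same right-hand side, so it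
can be absorbed (`le_of_interpolation`). Thus no pointwise bound on `u` and no iteration is needed.
-/

theorem gradient_mul_apply {n : ℕ} {f g : Rn n → ℝ} {x : Rn n} (hf : DifferentiableAt ℝ f x)
    (hg : DifferentiableAt ℝ g x) :
    gradient (fun y => f y * g y) x = f x • gradient g x + g x • gradient f x := by
  unfold gradient
  rw [fderiv_fun_mul hf hg]
  simp [map_add, map_smul]

theorem gradient_sub_apply {n : ℕ} {f g : Rn n → ℝ} {x : Rn n} (hf : DifferentiableAt ℝ f x)
    (hg : DifferentiableAt ℝ g x) :
    gradient (fun y => f y - g y) x = gradient f x - gradient g x := by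
  unfold gradient
  rw [fderiv_fun_sub hf hg]
  simp

theorem continuous_gradient {n : ℕ} {f : Rn n → ℝ} (hf : ContDiff ℝ ∞ f) :
    Continuous (gradient f) :=
  (LinearIsometryEquiv.continuous _).comp (hf.continuous_fderiv (by simp))

theorem norm_gradient {n : ℕ} (f : Rn n → ℝ) (x : Rn n) : ‖gradient f x‖ = ‖fderiv ℝ f x‖ := by
  simp [gradient]

theorem hasCompactSupport_gradient {n : ℕ} {f : Rn n → ℝ} (hf : HasCompactSupport f) :
    HasCompactSupport (gradient f) :=
  (hf.fderiv ℝ).comp_left (g := (InnerProductSpace.toDual ℝ (Rn n)).symm) (by simp)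

theorem IsTestFunction.mono {n : ℕ} {U V : Set (Rn n)} {φ : Rn n → ℝ} (h : IsTestFunction U φ)
    (hUV : U ⊆ V) : IsTestFunction V φ :=
  ⟨h.1, h.2.1, h.2.2.trans hUV⟩

theorem IsTestFunction.differentiable {n : ℕ} {U : Set (Rn n)} {φ : Rn n → ℝ}
    (h : IsTestFunction U φ) : Differentiable ℝ φ :=
  h.1.differentiable (by simp)

theorem IsTestFunction.sub {n : ℕ} {U : Set (Rn n)} {φ ψ : Rn n → ℝ} (h : IsTestFunction U φ)
    (h' : IsTestFunction U ψ) : IsTestFunction U (fun x => φ x - ψ x) :=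
  ⟨h.1.sub h'.1, h.2.1.sub h'.2.1,
    (tsupport_sub φ ψ).trans (Set.union_subset h.2.2 h'.2.2)⟩

theorem IsTestFunction.mul_left {n : ℕ} {U : Set (Rn n)} {φ ζ : Rn n → ℝ}
    (h : IsTestFunction U φ) (hζ : ContDiff ℝ ∞ ζ) : IsTestFunction U (fun x => ζ x * φ x) :=
  ⟨hζ.mul h.1, h.2.1.mul_left, (tsupport_mul_subset_right).trans h.2.2⟩

theorem IsTestFunction.memLp {n : ℕ} {U : Set (Rn n)} {φ : Rn n → ℝ} (h : IsTestFunction U φ)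
    (p : ℝ≥0∞) (μ : Measure (Rn n)) [IsFiniteMeasureOnCompacts μ] : MemLp φ p μ :=
  h.1.continuous.memLp_of_hasCompactSupport h.2.1

theorem IsTestFunction.memLp_gradient {n : ℕ} {U : Set (Rn n)} {φ : Rn n → ℝ}
    (h : IsTestFunction U φ) (p : ℝ≥0∞) (μ : Measure (Rn n)) [IsFiniteMeasureOnCompacts μ] :
    MemLp (gradient φ) p μ :=
  (continuous_gradient h.1).memLp_of_hasCompactSupport (hasCompactSupport_gradient h.2.1)

/-! ### The Sobolev inequality -/

/-- The Sobolev exponent `2n/(n-2)`. -/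
noncomputable def sobolevExponent (n : ℕ) : ℝ≥0∞ := ENNReal.ofReal (2 * (n : ℝ) / ((n : ℝ) - 2))

theorem exists_sobolev {n : ℕ} (hn : 3 ≤ n) :
    ∃ C : ℝ, 0 ≤ C ∧ ∀ φ : Rn n → ℝ, IsTestFunction Set.univ φ →
      eLpNorm φ (sobolevExponent n) volume ≤ ENNReal.ofReal C * eLpNorm (gradient φ) 2 volume := by
  have hn' : (3 : ℝ) ≤ n := by exact_mod_cast hn
  refine ⟨SNormLESNormFDerivOfEqConst ℝ (volume : Measure (Rn n)) ((2 : ℝ≥0) : ℝ),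
    NNReal.coe_nonneg _, fun φ hφ => ?_⟩
  have h := eLpNorm_le_eLpNorm_fderiv_of_eq (volume : Measure (Rn n)) (u := φ)
    (hφ.1.of_le (by simp)) hφ.2.1 (p := 2)
    (p' := (2 * (n : ℝ) / ((n : ℝ) - 2)).toNNReal) (by norm_num) (by simp; omega) (by
      rw [Real.coe_toNNReal _ (by apply div_nonneg <;> linarith)]
      simp only [NNReal.coe_inv, NNReal.coe_ofNat, finrank_euclideanSpace, Fintype.card_fin]
      have : (n : ℝ) - 2 ≠ 0 := by linarith
      field_simp)
  rw [ENNReal.ofReal_coe_nnreal]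
  convert h using 2
  · simp [sobolevExponent, ENNReal.ofReal]
  exact eLpNorm_congr_norm_ae (Eventually.of_forall fun x => norm_gradient φ x)

/-- The infimum defining `sobolevConst` is attained, because for each fixed `φ` the condition on `C`
is closed. The set is nonempty by `exists_sobolev`, without which `sInf` would take its default
value `0`. -/
theorem sobolev_inequality {n : ℕ} (hn : 3 ≤ n) {φ : Rn n → ℝ} (hφ : IsTestFunction Set.univ φ) :
    eLpNorm φ (sobolevExponent n) volume ≤
      ENNReal.ofReal (sobolevConst n) * eLpNorm (gradient φ) 2 volume := by
  have hne := exists_sobolev hn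
  have hfin : eLpNorm (gradient φ) 2 volume ≠ ⊤ := (hφ.memLp_gradient 2 volume).2.ne
  have hfin' : eLpNorm φ (sobolevExponent n) volume ≠ ⊤ := (hφ.memLp _ volume).2.ne
  rw [← ENNReal.ofReal_toReal hfin, ← ENNReal.ofReal_toReal hfin']
  have h0 : 0 ≤ sobolevConst n := Real.sInf_nonneg fun x hx => hx.1
  rw [← ENNReal.ofReal_mul h0]
  apply ENNReal.ofReal_le_ofReal
  have key : ∀ C ∈ {C : ℝ | 0 ≤ C ∧ ∀ φ : Rn n → ℝ, IsTestFunction Set.univ φ →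
      eLpNorm φ (sobolevExponent n) volume ≤ ENNReal.ofReal C * eLpNorm (gradient φ) 2 volume},
      (eLpNorm φ (sobolevExponent n) volume).toReal ≤ C * (eLpNorm (gradient φ) 2 volume).toReal := by
    intro C hC
    have := ENNReal.toReal_mono (ENNReal.mul_ne_top ENNReal.ofReal_ne_top hfin) (hC.2 φ hφ)
    rwa [ENNReal.toReal_mul, ENNReal.toReal_ofReal hC.1] at this
  rcases eq_or_lt_of_le (ENNReal.toReal_nonneg (a := eLpNorm (gradient φ) 2 volume)) with h | h
  · obtain ⟨C, hC⟩ := hne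
    have := key C hC
    rw [← h] at this ⊢
    simpa using this
  · rw [← div_le_iff₀ h]
    refine le_csInf hne fun C hC => ?_
    rw [div_le_iff₀ h]
    exact key C hC

theorem exists_isTestFunction_eq_one {n : ℕ} (x₀ : Rn n) :
    ∃ χ : Rn n → ℝ, IsTestFunction Set.univ χ ∧ (∀ x, 0 ≤ χ x) ∧ (∀ x, χ x ≤ 1) ∧
      (∀ x ∈ Metric.closedBall x₀ 1, χ x = 1) ∧ Function.support χ = Metric.ball x₀ 2 := by
  let f : ContDiffBump x₀ := ⟨1, 2, by norm_num, by norm_num⟩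
  exact ⟨f, ⟨f.contDiff, f.hasCompactSupport, Set.subset_univ _⟩, fun x => f.nonneg,
    fun x => f.le_one, fun x hx => f.one_of_mem_closedBall hx, f.support_eq⟩

theorem sobolevConst_pos {n : ℕ} (hn : 3 ≤ n) : 0 < sobolevConst n := by
  have h0 : 0 ≤ sobolevConst n := Real.sInf_nonneg fun x hx => hx.1
  refine lt_of_le_of_ne h0 fun h => ?_
  obtain ⟨χ, hχ, -, -, h1, -⟩ := exists_isTestFunction_eq_one (0 : Rn n)
  have := sobolev_inequality hn hχ
  rw [← h, ENNReal.ofReal_zero, zero_mul, nonpos_iff_eq_zero] at this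
  have hn' : (3 : ℝ) ≤ n := by exact_mod_cast hn
  rw [eLpNorm_eq_zero_iff hχ.1.continuous.aestronglyMeasurable (by
    simp only [sobolevExponent, ne_eq, ENNReal.ofReal_eq_zero, not_le]
    apply div_pos <;> linarith)] at this
  have := (hχ.1.continuous.ae_eq_iff_eq volume continuous_zero).1 this
  have h2 := h1 0 (by simp)
  simp [this] at h2

theorem eLpNorm_le_gradient_restrict {n : ℕ} (hn : 3 ≤ n) {U : Set (Rn n)} (hU : IsOpen U)
    {φ : Rn n → ℝ} (hφ : IsTestFunction U φ) :
    eLpNorm φ (sobolevExponent n) (volume.restrict U) ≤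
      ENNReal.ofReal (sobolevConst n) * eLpNorm (gradient φ) 2 (volume.restrict U) := by
  have h := sobolev_inequality hn (hφ.mono (Set.subset_univ U))
  have h1 : eLpNorm (gradient φ) 2 volume = eLpNorm (gradient φ) 2 (volume.restrict U) := by
    rw [← eLpNorm_indicator_eq_eLpNorm_restrict hU.measurableSet, Set.indicator_eq_self.2]
    refine subset_trans ?_ hφ.2.2
    intro x hx
    apply support_fderiv_subset ℝ
    intro h0
    apply hx
    simp [gradient, h0]
  rw [← h1]
  exact (eLpNorm_mono_measure _ Measure.restrict_le_self).trans h

/-- Fatou's lemma along an almost everywhere convergent subsequence. It carries Sobolev bounds from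
test functions to their `L²` limits, with no prior knowledge that the limit lies in `L^q`. -/
theorem eLpNorm_le_liminf_of_tendsto {α E : Type*} [MeasurableSpace α] {μ : Measure α}
    [NormedAddCommGroup E] {p q : ℝ≥0∞} (hp : p ≠ 0) {F : ℕ → α → E} {f : α → E} {K : ℕ → ℝ≥0∞}
    {K₀ : ℝ≥0∞} (hFm : ∀ k, AEStronglyMeasurable (F k) μ) (hfm : AEStronglyMeasurable f μ)
    (hF : Tendsto (fun k => eLpNorm (fun x => F k x - f x) p μ) atTop (𝓝 0))
    (hle : ∀ k, eLpNorm (F k) q μ ≤ K k) (hK : Tendsto K atTop (𝓝 K₀)) : eLpNorm f q μ ≤ K₀ := by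
  obtain ⟨ns, hns, hae⟩ :=
    (tendstoInMeasure_of_tendsto_eLpNorm hp hFm hfm hF).exists_seq_tendsto_ae
  refine (Lp.eLpNorm_lim_le_liminf_eLpNorm (fun i => hFm (ns i)) f hae).trans ?_
  have h2 := (hK.comp hns.tendsto_atTop).liminf_eq
  rw [← h2]
  exact liminf_le_liminf (Eventually.of_forall fun i => hle (ns i))

/-! ### Convergence in `L^p` and pairings -/

/-- The functions `F k` converge to `f` in `L^p(μ)`. -/
structure LpTendsto {α E : Type*} [MeasurableSpace α] [NormedAddCommGroup E] (p : ℝ≥0∞)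
    (μ : Measure α) (F : ℕ → α → E) (f : α → E) : Prop where
  memLp : ∀ k, MemLp (F k) p μ
  memLp_lim : MemLp f p μ
  tendsto : Tendsto (fun k => eLpNorm (fun x => F k x - f x) p μ) atTop (𝓝 0)

namespace LpTendsto

variable {α E : Type*} [MeasurableSpace α] [NormedAddCommGroup E] {p q r : ℝ≥0∞} {μ : Measure α}

theorem const {f : α → E} (hf : MemLp f p μ) : LpTendsto p μ (fun _ => f) f :=
  ⟨fun _ => hf, hf, by simp⟩

theorem add {F G : ℕ → α → E} {f g : α → E} (hp : 1 ≤ p) (hF : LpTendsto p μ F f)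
    (hG : LpTendsto p μ G g) : LpTendsto p μ (fun k x => F k x + G k x) (fun x => f x + g x) := by
  refine ⟨fun k => (hF.memLp k).add (hG.memLp k), hF.memLp_lim.add hG.memLp_lim, ?_⟩
  have h := hF.tendsto.add hG.tendsto
  rw [add_zero] at h
  refine tendsto_of_tendsto_of_tendsto_of_le_of_le tendsto_const_nhds h (fun _ => zero_le)
    fun k => ?_
  have := eLpNorm_add_le ((hF.memLp k).sub hF.memLp_lim).1 ((hG.memLp k).sub hG.memLp_lim).1 hp
  refine le_trans (le_of_eq ?_) this
  congr 1
  ext x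
  simp only [Pi.add_apply, Pi.sub_apply]
  abel

variable [NormedSpace ℝ E]

theorem const_smul {F : ℕ → α → E} {f : α → E} {h : α → ℝ} [hpqr : p.HolderTriple q r]
    (hh : MemLp h p μ) (hF : LpTendsto q μ F f) :
    LpTendsto r μ (fun k x => h x • F k x) (fun x => h x • f x) := by
  refine ⟨fun k => (hF.memLp k).smul hh, hF.memLp_lim.smul hh, ?_⟩
  have h0 := ENNReal.Tendsto.const_mul (a := eLpNorm h p μ) hF.tendsto (Or.inr hh.2.ne)
  rw [mul_zero] at h0
  refine tendsto_of_tendsto_of_tendsto_of_le_of_le tendsto_const_nhds h0 (fun _ => zero_le)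
    fun k => ?_
  have := eLpNorm_smul_le_mul_eLpNorm (p := p) (q := q) (r := r)
      ((hF.memLp k).sub hF.memLp_lim).1 hh.1
  refine le_trans (le_of_eq ?_) this
  congr 1
  ext x
  simp [smul_sub]

theorem smul_const {F : ℕ → α → ℝ} {f : α → ℝ} {v : α → E} [hpqr : p.HolderTriple q r]
    (hF : LpTendsto p μ F f) (hv : MemLp v q μ) :
    LpTendsto r μ (fun k x => F k x • v x) (fun x => f x • v x) := by
  refine ⟨fun k => hv.smul (hF.memLp k), hv.smul hF.memLp_lim, ?_⟩
  have h0 := ENNReal.Tendsto.mul_const (b := eLpNorm v q μ) hF.tendsto (Or.inr hv.2.ne)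
  rw [zero_mul] at h0
  refine tendsto_of_tendsto_of_tendsto_of_le_of_le tendsto_const_nhds h0 (fun _ => zero_le)
    fun k => ?_
  have := eLpNorm_smul_le_mul_eLpNorm (p := p) (q := q) (r := r) hv.1
      ((hF.memLp k).sub hF.memLp_lim).1
  refine le_trans (le_of_eq ?_) this
  congr 1
  ext x
  simp [sub_smul]

end LpTendsto

theorem MeasureTheory.MemLp.integrable_inner_two {α E : Type*} [MeasurableSpace α]
    [NormedAddCommGroup E] [InnerProductSpace ℝ E] {μ : Measure α} {f g : α → E}
    (hf : MemLp f 2 μ) (hg : MemLp g 2 μ) : Integrable (fun x => inner ℝ (f x) (g x)) μ := by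
  have h := L2.integrable_inner (𝕜 := ℝ) (hf.toLp f) (hg.toLp g)
  refine h.congr ?_
  filter_upwards [hf.coeFn_toLp, hg.coeFn_toLp] with x h1 h2
  rw [h1, h2]

theorem integral_inner_toLp {α E : Type*} [MeasurableSpace α]
    [NormedAddCommGroup E] [InnerProductSpace ℝ E] {μ : Measure α} {f g : α → E}
    (hf : MemLp f 2 μ) (hg : MemLp g 2 μ) :
    inner ℝ (hf.toLp f) (hg.toLp g) = ∫ x, inner ℝ (f x) (g x) ∂μ := by
  rw [L2.inner_def]
  refine integral_congr_ae ?_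
  filter_upwards [hf.coeFn_toLp, hg.coeFn_toLp] with x h1 h2
  rw [h1, h2]

theorem LpTendsto.tendsto_integral_inner {α E : Type*} [MeasurableSpace α]
    [NormedAddCommGroup E] [InnerProductSpace ℝ E] {μ : Measure α} {F G : ℕ → α → E} {f g : α → E}
    (hF : LpTendsto 2 μ F f) (hG : LpTendsto 2 μ G g) :
    Tendsto (fun k => ∫ x, inner ℝ (F k x) (G k x) ∂μ) atTop (𝓝 (∫ x, inner ℝ (f x) (g x) ∂μ)) := by
  have h1 := (Lp.tendsto_Lp_iff_tendsto_eLpNorm'' F hF.memLp f hF.memLp_lim).2 hF.tendsto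
  have h2 := (Lp.tendsto_Lp_iff_tendsto_eLpNorm'' G hG.memLp g hG.memLp_lim).2 hG.tendsto
  have h3 := h1.inner (𝕜 := ℝ) h2
  rw [integral_inner_toLp] at h3
  exact h3.congr fun k => integral_inner_toLp _ _

theorem integral_mul_le_eLpNorm_two {α : Type*} [MeasurableSpace α] {μ : Measure α} {f g : α → ℝ}
    (hf : MemLp f 2 μ) (hg : MemLp g 2 μ) :
    ∫ x, f x * g x ∂μ ≤ (eLpNorm f 2 μ).toReal * (eLpNorm g 2 μ).toReal := by
  have h := real_inner_le_norm (hf.toLp f) (hg.toLp g)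
  rw [integral_inner_toLp, Lp.norm_toLp, Lp.norm_toLp] at h
  refine le_trans (le_of_eq ?_) h
  congr 1
  ext x
  simp [mul_comm]

theorem integral_sq_eq_eLpNorm_two {α : Type*} [MeasurableSpace α] {μ : Measure α} {f : α → ℝ}
    (hf : MemLp f 2 μ) : ∫ x, f x ^ 2 ∂μ = (eLpNorm f 2 μ).toReal ^ 2 := by
  have h := real_inner_self_eq_norm_sq (hf.toLp f)
  rw [integral_inner_toLp, Lp.norm_toLp] at h
  rw [← h]
  congr 1
  ext x
  simp [sq]

/-- This is the criticality of the lower-order terms: an `L^n` coefficient times a function with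
finite Sobolev norm is in `L²`, and can be paired with a gradient. -/
theorem holderTriple_sobolevExponent {n : ℕ} (hn : 3 ≤ n) :
    ENNReal.HolderTriple (n : ℝ≥0∞) (sobolevExponent n) 2 := by
  have hn' : (3 : ℝ) ≤ n := by exact_mod_cast hn
  constructor
  have h1 : (n : ℝ≥0∞) = ENNReal.ofReal n := by simp
  have h2 : (2 : ℝ≥0∞) = ENNReal.ofReal 2 := by simp
  rw [sobolevExponent, h1, h2, ← ENNReal.ofReal_inv_of_pos (by linarith),
    ← ENNReal.ofReal_inv_of_pos (by apply div_pos <;> linarith),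
    ← ENNReal.ofReal_inv_of_pos (by linarith), ← ENNReal.ofReal_add (by positivity)
      (by rw [inv_div]; apply div_nonneg <;> linarith)]
  congr 1
  have : (n : ℝ) - 2 ≠ 0 := by linarith
  field_simp
  ring

/-- The factors are `sign d · |d|^(1/2)` and `|d|^(1/2)`. Splitting `d` this way turns the
zeroth-order term into a pairing of two `L²` functions, like the drift terms. -/
theorem exists_memLp_mul_eq {α : Type*} [MeasurableSpace α] {μ : Measure α} {n : ℕ} {d : α → ℝ}
    (hd : MemLp d ((n : ℝ≥0∞) / 2) μ) :
    ∃ d₁ d₂ : α → ℝ, MemLp d₁ n μ ∧ MemLp d₂ n μ ∧ ∀ x, d x = d₁ x * d₂ x := by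
  have h1 : MemLp (fun x => ‖d x‖ ^ (1 / 2 : ℝ)) n μ := by
    have := hd.norm_rpow_div (1 / 2)
    have h2 : (n : ℝ≥0∞) / 2 / (1 / 2) = n := by
      rw [one_div, div_eq_mul_inv, inv_inv]
      exact ENNReal.div_mul_cancel (by norm_num) (by norm_num)
    rw [h2] at this
    simpa using this
  have h3 : MemLp (fun x => (SignType.sign (d x) : ℝ) * ‖d x‖ ^ (1 / 2 : ℝ)) n μ := by
    refine h1.of_le (AEStronglyMeasurable.mul ?_ h1.1) (Eventually.of_forall fun x => ?_)
    · have hm : Measurable fun t : ℝ => ((SignType.sign t : SignType) : ℝ) := by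
        have : (fun t : ℝ => ((SignType.sign t : SignType) : ℝ)) =
            fun t => if 0 < t then 1 else if t < 0 then -1 else 0 := by
          ext t
          rw [sign_apply]
          split_ifs <;> simp
        rw [this]
        exact Measurable.ite measurableSet_Ioi measurable_const
          (Measurable.ite measurableSet_Iio measurable_const measurable_const)
      exact (hm.comp_aemeasurable hd.1.aemeasurable).aestronglyMeasurable
    · rw [norm_mul]
      refine mul_le_of_le_one_left (norm_nonneg _) ?_
      rcases SignType.sign (d x) with _ | _ | _ <;> simp
  refine ⟨_, _, h3, h1, fun x => ?_⟩
  rw [mul_assoc, ← Real.rpow_add_of_nonneg (norm_nonneg _) (by norm_num) (by norm_num)]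
  norm_num [sign_mul_abs]

/-! ### The energy inequality -/

section Energy

variable {α E : Type*} [MeasurableSpace α] [NormedAddCommGroup E] [InnerProductSpace ℝ E]
  {μ : Measure α}

theorem memLp_clm_apply {A : α → E →L[ℝ] E} {g : α → E} {K : ℝ} {p : ℝ≥0∞}
    (hA : AEStronglyMeasurable A μ) (hAb : ∀ᵐ x ∂μ, ‖A x‖ ≤ K) (hg : MemLp g p μ) :
    MemLp (fun x => A x (g x)) p μ := by
  refine hg.of_le_mul (c := K)
    ((ContinuousLinearMap.id ℝ (E →L[ℝ] E)).aestronglyMeasurable_comp₂ hA hg.1) ?_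
  filter_upwards [hAb] with x hx
  exact (A x).le_of_opNorm_le hx _

/-- Convergence in `L²` of the gradients of the cut-off products `ζ² φ`, written out. -/
theorem tendsto_cutoff_grad {φ : ℕ → α → ℝ} {w ζ : α → ℝ} {G : ℕ → α → E}
    {Dw Dζ : α → E} (hφ : LpTendsto 2 μ φ w) (hG : LpTendsto 2 μ G Dw) (hζ : MemLp ζ ⊤ μ)
    (hDζ : MemLp Dζ ⊤ μ) :
    LpTendsto 2 μ (fun k x => ζ x • ζ x • G k x + (2 : ℝ) • ζ x • φ k x • Dζ x)
      (fun x => ζ x • ζ x • Dw x + (2 : ℝ) • ζ x • w x • Dζ x) := by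
  have h2 : MemLp (fun _ : α => (2 : ℝ)) ⊤ μ := memLp_top_const 2
  have h1 : LpTendsto 2 μ _ _ := hG.const_smul hζ
  have h3 : LpTendsto 2 μ _ _ := hφ.smul_const (r := 2) hDζ
  have h4 : LpTendsto 2 μ _ _ := h3.const_smul hζ
  exact LpTendsto.add (by norm_num) (h1.const_smul hζ) (h4.const_smul h2)

theorem integral_add_add {f g h : α → ℝ} (hf : Integrable f μ) (hg : Integrable g μ)
    (hh : Integrable h μ) :
    ∫ x, (f x + g x + h x) ∂μ = ∫ x, f x ∂μ + ∫ x, g x ∂μ + ∫ x, h x ∂μ := by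
  rw [← integral_add hf hg]
  exact integral_add (hf.add hg) hh

variable {n : ℕ} {s : ℝ≥0∞} [ENNReal.HolderTriple (n : ℝ≥0∞) s 2]
  {b c : α → E} {d : α → ℝ} {V Dw Dζ : α → E} {φ : ℕ → α → ℝ} {w ζ : α → ℝ} {G : ℕ → α → E}

/-- Only the test function is approximated; the solution `w` stays fixed. Passing to the limit makes
`ζ² w` itself an admissible test function. -/
theorem weak_form_limit (hV : MemLp V 2 μ) (hb : MemLp b n μ) (hc : MemLp c n μ)
    (hd : MemLp d ((n : ℝ≥0∞) / 2) μ) (hφ : LpTendsto 2 μ φ w) (hφs : LpTendsto s μ φ w)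
    (hG : LpTendsto 2 μ G Dw) (hζ : MemLp ζ ⊤ μ) (hDζ : MemLp Dζ ⊤ μ)
    (hw : ∀ k, ∫ x, (inner ℝ (V x) (ζ x • ζ x • G k x + (2 : ℝ) • ζ x • φ k x • Dζ x)
      + inner ℝ (b x) (ζ x • ζ x • G k x + (2 : ℝ) • ζ x • φ k x • Dζ x) * w x
      + inner ℝ (c x) (Dw x) * (ζ x * ζ x * φ k x) + d x * w x * (ζ x * ζ x * φ k x)) ∂μ = 0) :
    Integrable (fun x => inner ℝ (V x) (ζ x • ζ x • Dw x + (2 : ℝ) • ζ x • w x • Dζ x)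
      + inner ℝ (b x) (ζ x • ζ x • Dw x + (2 : ℝ) • ζ x • w x • Dζ x) * w x
      + inner ℝ (c x) (Dw x) * (ζ x * ζ x * w x) + d x * w x * (ζ x * ζ x * w x)) μ ∧
    ∫ x, (inner ℝ (V x) (ζ x • ζ x • Dw x + (2 : ℝ) • ζ x • w x • Dζ x)
      + inner ℝ (b x) (ζ x • ζ x • Dw x + (2 : ℝ) • ζ x • w x • Dζ x) * w x
      + inner ℝ (c x) (Dw x) * (ζ x * ζ x * w x) + d x * w x * (ζ x * ζ x * w x)) ∂μ = 0 := by
  obtain ⟨d₁, d₂, hd₁, hd₂, hd₃⟩ := exists_memLp_mul_eq hd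
  have : ENNReal.HolderTriple s n 2 := ENNReal.HolderTriple.symm
  have H := tendsto_cutoff_grad hφ hG hζ hDζ
  have hwb : MemLp (fun x => w x • b x) 2 μ := hb.smul hφs.memLp_lim
  have P1 := LpTendsto.const (f := fun x => V x + w x • b x) (hV.add hwb)
  have P2 := LpTendsto.const hG.memLp_lim
  have q2 : LpTendsto 2 μ _ _ := hφs.smul_const (r := 2) hc
  have q2' : LpTendsto 2 μ _ _ := q2.const_smul hζ
  have Q2 : LpTendsto 2 μ _ _ := q2'.const_smul hζ
  have hdw : MemLp (fun x => d₁ x • w x) 2 μ := hφs.memLp_lim.smul hd₁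
  have P3 := LpTendsto.const hdw
  have q3 : LpTendsto 2 μ _ _ := hφs.const_smul (r := 2) hd₂
  have q3' : LpTendsto 2 μ _ _ := q3.const_smul hζ
  have Q3 : LpTendsto 2 μ _ _ := q3'.const_smul hζ
  have L := ((P1.tendsto_integral_inner H).add (P2.tendsto_integral_inner Q2)).add
    (P3.tendsto_integral_inner Q3)
  have i1 := P1.memLp_lim.integrable_inner_two H.memLp_lim
  have i2 := P2.memLp_lim.integrable_inner_two Q2.memLp_lim
  have i3 := P3.memLp_lim.integrable_inner_two Q3.memLp_lim
  -- Each coefficient in `L^n` is attached to a factor with finite Sobolev norm, so that the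
  -- integrand becomes three inner products of `L²` functions and continuity of the `L²` pairing
  -- applies.
  have pw : ∀ (Gx Dwx Dζx Vx bx cx : E) (ζx φx wx d₁x d₂x : ℝ),
      inner ℝ Vx (ζx • ζx • Gx + (2 : ℝ) • ζx • φx • Dζx)
      + inner ℝ bx (ζx • ζx • Gx + (2 : ℝ) • ζx • φx • Dζx) * wx
      + inner ℝ cx Dwx * (ζx * ζx * φx) + d₁x * d₂x * wx * (ζx * ζx * φx) =
      inner ℝ (Vx + wx • bx) (ζx • ζx • Gx + (2 : ℝ) • ζx • φx • Dζx)
      + inner ℝ Dwx (ζx • ζx • φx • cx)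
      + inner ℝ (d₁x • wx) (ζx • ζx • d₂x • φx) := by
    intros
    simp only [inner_add_left, inner_smul_left, inner_smul_right, smul_eq_mul, RCLike.inner_apply,
      conj_trivial, real_inner_comm]
    ring
  simp only [hd₃, pw] at hw ⊢
  refine ⟨(i1.add i2).add i3, ?_⟩
  refine (integral_add_add i1 i2 i3).trans ?_
  refine tendsto_nhds_unique L (tendsto_const_nhds.congr fun k => ?_)
  have j1 := (P1.memLp k).integrable_inner_two (H.memLp k)
  have j2 := (P2.memLp k).integrable_inner_two (Q2.memLp k)
  have j3 := (P3.memLp k).integrable_inner_two (Q3.memLp k)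
  rw [← hw k]
  exact integral_add_add j1 j2 j3

/-- The inequality `d ≥ div b` is tested with `(ζ φ k)²`, which is smooth and nonnegative, whereas
`ζ² w²` need not be smooth. The gradient is written as `φ ∇(ζ² φ) + ζ² φ ∇φ`, to match the terms of
the weak form. -/
theorem geDiv_limit (hb : MemLp b n μ)
    (hd : MemLp d ((n : ℝ≥0∞) / 2) μ) (hφ : LpTendsto 2 μ φ w) (hφs : LpTendsto s μ φ w)
    (hG : LpTendsto 2 μ G Dw) (hζ : MemLp ζ ⊤ μ) (hDζ : MemLp Dζ ⊤ μ)
    (hw : ∀ k, 0 ≤ ∫ x, (inner ℝ (b x) (φ k x • (ζ x • ζ x • G k x + (2 : ℝ) • ζ x • φ k x • Dζ x)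
      + (ζ x * ζ x * φ k x) • G k x) + d x * (ζ x * ζ x * φ k x * φ k x)) ∂μ) :
    Integrable (fun x => inner ℝ (b x) (w x • (ζ x • ζ x • Dw x + (2 : ℝ) • ζ x • w x • Dζ x)
      + (ζ x * ζ x * w x) • Dw x) + d x * (ζ x * ζ x * w x * w x)) μ ∧
    0 ≤ ∫ x, (inner ℝ (b x) (w x • (ζ x • ζ x • Dw x + (2 : ℝ) • ζ x • w x • Dζ x)
      + (ζ x * ζ x * w x) • Dw x) + d x * (ζ x * ζ x * w x * w x)) ∂μ := by
  obtain ⟨d₁, d₂, hd₁, hd₂, hd₃⟩ := exists_memLp_mul_eq hd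
  have : ENNReal.HolderTriple s n 2 := ENNReal.HolderTriple.symm
  have H := tendsto_cutoff_grad hφ hG hζ hDζ
  have P1 : LpTendsto 2 μ _ _ := hφs.smul_const (r := 2) hb
  have q2 : LpTendsto 2 μ _ _ := P1.const_smul hζ
  have Q2 : LpTendsto 2 μ _ _ := q2.const_smul hζ
  have P3 : LpTendsto 2 μ _ _ := hφs.const_smul (r := 2) hd₁
  have q3 : LpTendsto 2 μ _ _ := hφs.const_smul (r := 2) hd₂
  have q3' : LpTendsto 2 μ _ _ := q3.const_smul hζ
  have Q3 : LpTendsto 2 μ _ _ := q3'.const_smul hζ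
  have L := ((P1.tendsto_integral_inner H).add (hG.tendsto_integral_inner Q2)).add
    (P3.tendsto_integral_inner Q3)
  have i1 := P1.memLp_lim.integrable_inner_two H.memLp_lim
  have i2 := hG.memLp_lim.integrable_inner_two Q2.memLp_lim
  have i3 := P3.memLp_lim.integrable_inner_two Q3.memLp_lim
  have pw : ∀ (Gx Dζx bx : E) (ζx φx d₁x d₂x : ℝ),
      inner ℝ bx (φx • (ζx • ζx • Gx + (2 : ℝ) • ζx • φx • Dζx)
      + (ζx * ζx * φx) • Gx) + d₁x * d₂x * (ζx * ζx * φx * φx) =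
      inner ℝ (φx • bx) (ζx • ζx • Gx + (2 : ℝ) • ζx • φx • Dζx)
      + inner ℝ Gx (ζx • ζx • φx • bx)
      + inner ℝ (d₁x • φx) (ζx • ζx • d₂x • φx) := by
    intros
    simp only [inner_add_right, inner_smul_left, inner_smul_right, smul_eq_mul, RCLike.inner_apply,
      conj_trivial, real_inner_comm]
    ring
  simp only [hd₃, pw] at hw ⊢
  refine ⟨(i1.add i2).add i3, ?_⟩
  refine le_of_le_of_eq ?_ (integral_add_add i1 i2 i3).symm
  refine ge_of_tendsto' L fun k => ?_
  have j1 := (P1.memLp k).integrable_inner_two (H.memLp k)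
  have j2 := (hG.memLp k).integrable_inner_two (Q2.memLp k)
  have j3 := (P3.memLp k).integrable_inner_two (Q3.memLp k)
  exact (hw k).trans (le_of_eq (integral_add_add j1 j2 j3))

/-- The energy inequality when `d ≥ div b`. -/
theorem energy_inequality_left (hV : MemLp V 2 μ) (hb : MemLp b n μ) (hc : MemLp c n μ)
    (hd : MemLp d ((n : ℝ≥0∞) / 2) μ) (hφ : LpTendsto 2 μ φ w) (hφs : LpTendsto s μ φ w)
    (hG : LpTendsto 2 μ G Dw) (hζ : MemLp ζ ⊤ μ) (hDζ : MemLp Dζ ⊤ μ)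
    (hw : ∀ k, ∫ x, (inner ℝ (V x) (ζ x • ζ x • G k x + (2 : ℝ) • ζ x • φ k x • Dζ x)
      + inner ℝ (b x) (ζ x • ζ x • G k x + (2 : ℝ) • ζ x • φ k x • Dζ x) * w x
      + inner ℝ (c x) (Dw x) * (ζ x * ζ x * φ k x) + d x * w x * (ζ x * ζ x * φ k x)) ∂μ = 0)
    (hdiv : ∀ k, 0 ≤ ∫ x, (inner ℝ (b x)
      (φ k x • (ζ x • ζ x • G k x + (2 : ℝ) • ζ x • φ k x • Dζ x)
        + (ζ x * ζ x * φ k x) • G k x) + d x * (ζ x * ζ x * φ k x * φ k x)) ∂μ) :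
    Integrable (fun x => inner ℝ (V x) (ζ x • ζ x • Dw x + (2 : ℝ) • ζ x • w x • Dζ x)
      - inner ℝ (b x - c x) (Dw x) * (ζ x * ζ x * w x)) μ ∧
    ∫ x, (inner ℝ (V x) (ζ x • ζ x • Dw x + (2 : ℝ) • ζ x • w x • Dζ x)
      - inner ℝ (b x - c x) (Dw x) * (ζ x * ζ x * w x)) ∂μ ≤ 0 := by
  obtain ⟨i1, e1⟩ := weak_form_limit hV hb hc hd hφ hφs hG hζ hDζ hw
  obtain ⟨i2, e2⟩ := geDiv_limit hb hd hφ hφs hG hζ hDζ hdiv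
  -- Subtracting the divergence inequality from the equation cancels `d` and the term `b · ∇(ζ² w)
  -- w`; of the drift only `(c - b) · ∇w ζ² w` survives.
  have pw : ∀ x, inner ℝ (V x) (ζ x • ζ x • Dw x + (2 : ℝ) • ζ x • w x • Dζ x)
      - inner ℝ (b x - c x) (Dw x) * (ζ x * ζ x * w x) =
      (inner ℝ (V x) (ζ x • ζ x • Dw x + (2 : ℝ) • ζ x • w x • Dζ x)
      + inner ℝ (b x) (ζ x • ζ x • Dw x + (2 : ℝ) • ζ x • w x • Dζ x) * w x
      + inner ℝ (c x) (Dw x) * (ζ x * ζ x * w x) + d x * w x * (ζ x * ζ x * w x)) -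
      (inner ℝ (b x) (w x • (ζ x • ζ x • Dw x + (2 : ℝ) • ζ x • w x • Dζ x)
      + (ζ x * ζ x * w x) • Dw x) + d x * (ζ x * ζ x * w x * w x)) := by
    intro x
    simp only [inner_sub_left, inner_add_right, inner_smul_right]
    ring
  simp only [pw]
  refine ⟨i1.sub i2, ?_⟩
  rw [integral_sub i1 i2, e1]
  linarith

/-- The energy inequality when `d ≥ div c`. -/
theorem energy_inequality_right (hV : MemLp V 2 μ) (hb : MemLp b n μ) (hc : MemLp c n μ)
    (hd : MemLp d ((n : ℝ≥0∞) / 2) μ) (hφ : LpTendsto 2 μ φ w) (hφs : LpTendsto s μ φ w)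
    (hG : LpTendsto 2 μ G Dw) (hζ : MemLp ζ ⊤ μ) (hDζ : MemLp Dζ ⊤ μ)
    (hw : ∀ k, ∫ x, (inner ℝ (V x) (ζ x • ζ x • G k x + (2 : ℝ) • ζ x • φ k x • Dζ x)
      + inner ℝ (b x) (ζ x • ζ x • G k x + (2 : ℝ) • ζ x • φ k x • Dζ x) * w x
      + inner ℝ (c x) (Dw x) * (ζ x * ζ x * φ k x) + d x * w x * (ζ x * ζ x * φ k x)) ∂μ = 0)
    (hdiv : ∀ k, 0 ≤ ∫ x, (inner ℝ (c x)
      (φ k x • (ζ x • ζ x • G k x + (2 : ℝ) • ζ x • φ k x • Dζ x)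
        + (ζ x * ζ x * φ k x) • G k x) + d x * (ζ x * ζ x * φ k x * φ k x)) ∂μ) :
    Integrable (fun x => inner ℝ (V x) (ζ x • ζ x • Dw x + (2 : ℝ) • ζ x • w x • Dζ x)
      + inner ℝ (b x - c x) (ζ x • ζ x • Dw x + (2 : ℝ) • ζ x • w x • Dζ x) * w x) μ ∧
    ∫ x, (inner ℝ (V x) (ζ x • ζ x • Dw x + (2 : ℝ) • ζ x • w x • Dζ x)
      + inner ℝ (b x - c x) (ζ x • ζ x • Dw x + (2 : ℝ) • ζ x • w x • Dζ x) * w x) ∂μ ≤ 0 := by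
  obtain ⟨i1, e1⟩ := weak_form_limit hV hb hc hd hφ hφs hG hζ hDζ hw
  obtain ⟨i2, e2⟩ := geDiv_limit hc hd hφ hφs hG hζ hDζ hdiv
  -- Here the term `c · ∇w ζ² w` cancels instead, and the drift that survives is `(b - c) · ∇(ζ² w)
  -- w`.
  have pw : ∀ x, inner ℝ (V x) (ζ x • ζ x • Dw x + (2 : ℝ) • ζ x • w x • Dζ x)
      + inner ℝ (b x - c x) (ζ x • ζ x • Dw x + (2 : ℝ) • ζ x • w x • Dζ x) * w x =
      (inner ℝ (V x) (ζ x • ζ x • Dw x + (2 : ℝ) • ζ x • w x • Dζ x)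
      + inner ℝ (b x) (ζ x • ζ x • Dw x + (2 : ℝ) • ζ x • w x • Dζ x) * w x
      + inner ℝ (c x) (Dw x) * (ζ x * ζ x * w x) + d x * w x * (ζ x * ζ x * w x)) -
      (inner ℝ (c x) (w x • (ζ x • ζ x • Dw x + (2 : ℝ) • ζ x • w x • Dζ x)
      + (ζ x * ζ x * w x) • Dw x) + d x * (ζ x * ζ x * w x * w x)) := by
    intro x
    simp only [inner_sub_left, inner_add_right, inner_smul_right]
    ring
  simp only [pw]
  refine ⟨i1.sub i2, ?_⟩
  rw [integral_sub i1 i2, e1]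
  linarith

end Energy

/-! ### Absorption of the drift -/

/-- The constant of the Caccioppoli inequality with drift. -/
noncomputable def caccioppoliConst (lam Lam T : ℝ) : ℝ :=
  3 / lam * (3 * (2 * Lam + lam) ^ 2 / (2 * lam) + 2 * lam / 3 + T + 3 * T ^ 2 / (2 * lam))

theorem caccioppoliConst_nonneg {lam T : ℝ} (Lam : ℝ) (hlam : 0 < lam) (hT : 0 ≤ T) :
    0 ≤ caccioppoliConst lam Lam T := by
  unfold caccioppoliConst
  positivity

/-- The large part of the drift costs `λ/3` of the coefficient of `P²`; Young's inequality for the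
products `P Z` and `W P` costs `λ/6` each. A third of the ellipticity is left, whence the factor
`3/λ` in `caccioppoliConst`. -/
theorem sq_le_of_absorb {lam Lam T P Z W : ℝ} (hlam : 0 < lam) (hT : 0 ≤ T)
    (h : lam * P ^ 2 ≤ 2 * Lam * (P * Z) + lam / 3 * (P + Z) * (P + 2 * Z) + T * W * (P + 2 * Z)) :
    P ^ 2 ≤ caccioppoliConst lam Lam T * (Z ^ 2 + W ^ 2) := by
  set a := 2 * Lam + lam with ha
  have h1 : a * (P * Z) ≤ lam / 6 * P ^ 2 + 3 * a ^ 2 / (2 * lam) * Z ^ 2 := by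
    have : lam / 6 * P ^ 2 + 3 * a ^ 2 / (2 * lam) * Z ^ 2 - a * (P * Z) =
        1 / (6 * lam) * (lam * P - 3 * a * Z) ^ 2 := by field_simp; ring
    have h0 : 0 ≤ 1 / (6 * lam) * (lam * P - 3 * a * Z) ^ 2 := by positivity
    linarith
  have h2 : T * (W * P) ≤ lam / 6 * P ^ 2 + 3 * T ^ 2 / (2 * lam) * W ^ 2 := by
    have : lam / 6 * P ^ 2 + 3 * T ^ 2 / (2 * lam) * W ^ 2 - T * (W * P) =
        1 / (6 * lam) * (lam * P - 3 * T * W) ^ 2 := by field_simp; ring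
    have h0 : 0 ≤ 1 / (6 * lam) * (lam * P - 3 * T * W) ^ 2 := by positivity
    linarith
  have h3 : T * (2 * (W * Z)) ≤ T * (W ^ 2 + Z ^ 2) :=
    mul_le_mul_of_nonneg_left (by nlinarith [sq_nonneg (W - Z)]) hT
  have h4 : lam / 3 * P ^ 2 ≤ (3 * a ^ 2 / (2 * lam) + 2 * lam / 3 + T + 3 * T ^ 2 / (2 * lam)) *
      (Z ^ 2 + W ^ 2) := by
    have e1 : 0 ≤ 3 * a ^ 2 / (2 * lam) * W ^ 2 := by positivity
    have e2 : 0 ≤ 2 * lam / 3 * W ^ 2 := by positivity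
    have e3 : 0 ≤ 3 * T ^ 2 / (2 * lam) * Z ^ 2 := by positivity
    have e4 : 2 * Lam * (P * Z) = a * (P * Z) - lam * (P * Z) := by rw [ha]; ring
    linarith
  calc P ^ 2 = 3 / lam * (lam / 3 * P ^ 2) := by field_simp
    _ ≤ 3 / lam * ((3 * a ^ 2 / (2 * lam) + 2 * lam / 3 + T + 3 * T ^ 2 / (2 * lam)) *
      (Z ^ 2 + W ^ 2)) := mul_le_mul_of_nonneg_left h4 (by positivity)
    _ = _ := by unfold caccioppoliConst; ring

theorem eLpNorm_fun_mul_le {α : Type*} [MeasurableSpace α] {μ : Measure α} {p q r : ℝ≥0∞}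
    [ENNReal.HolderTriple p q r] {f g : α → ℝ} (hg : AEStronglyMeasurable g μ)
    (hf : AEStronglyMeasurable f μ) :
    eLpNorm (fun x => f x * g x) r μ ≤ eLpNorm f p μ * eLpNorm g q μ := by
  have h := eLpNorm_smul_le_mul_eLpNorm (p := p) (q := q) (r := r) hg hf
  rwa [show f • g = fun x => f x * g x from rfl] at h

/-- In the application `p = ζ |∇w|`, `z = |w| |∇ζ|`, `v = ζ |w|`, `f = |b - c|`, `f₁` is the large
part of `f`, and `J` is the energy integrand. Hölder and Sobolev bound the `L²` norm of `f₁ v` by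
`λ/(3C) · C (P + Z)`, so the Sobolev constant drops out. -/
theorem caccioppoli_of_energy {α : Type*} [MeasurableSpace α] {μ : Measure α} {n : ℕ} {s : ℝ≥0∞}
    [hns : ENNReal.HolderTriple (n : ℝ≥0∞) s 2] {lam Lam T C : ℝ} (hlam : 0 < lam) (hLam : 0 ≤ Lam)
    (hT : 0 ≤ T) (hC : 0 < C) {J p z v f f₁ : α → ℝ} (hJ : Integrable J μ) (hJ0 : ∫ x, J x ∂μ ≤ 0)
    (hp : MemLp p 2 μ) (hz : MemLp z 2 μ) (hv : MemLp v 2 μ) (hvs : MemLp v s μ)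
    (hf₁ : MemLp f₁ n μ) (hp0 : ∀ x, 0 ≤ p x) (hz0 : ∀ x, 0 ≤ z x) (hv0 : ∀ x, 0 ≤ v x)
    (hf : ∀ᵐ x ∂μ, f x ≤ f₁ x + T)
    (hJle : ∀ᵐ x ∂μ, lam * p x ^ 2 - 2 * Lam * (p x * z x) - f x * v x * (p x + 2 * z x) ≤ J x)
    (hf₁n : eLpNorm f₁ n μ ≤ ENNReal.ofReal (lam / (3 * C)))
    (hsob : eLpNorm v s μ ≤ ENNReal.ofReal C * (eLpNorm p 2 μ + eLpNorm z 2 μ)) :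
    (eLpNorm p 2 μ).toReal ^ 2 ≤ caccioppoliConst lam Lam T *
      ((eLpNorm z 2 μ).toReal ^ 2 + (eLpNorm v 2 μ).toReal ^ 2) := by
  set P := (eLpNorm p 2 μ).toReal with hP
  set Z := (eLpNorm z 2 μ).toReal with hZ
  set W := (eLpNorm v 2 μ).toReal with hW
  have hfv : MemLp (fun x => f₁ x * v x) 2 μ := hvs.mul' (p := n) (r := 2) hf₁
  have hfvn : (eLpNorm (fun x => f₁ x * v x) 2 μ).toReal ≤ lam / 3 * (P + Z) := by
    have h1 : eLpNorm (fun x => f₁ x * v x) 2 μ ≤ eLpNorm f₁ n μ * eLpNorm v s μ :=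
      eLpNorm_fun_mul_le hvs.1 hf₁.1
    have h2 : eLpNorm (fun x => f₁ x * v x) 2 μ ≤
        ENNReal.ofReal (lam / (3 * C)) * (ENNReal.ofReal C * (eLpNorm p 2 μ + eLpNorm z 2 μ)) :=
      h1.trans (mul_le_mul' hf₁n hsob)
    have h3 := ENNReal.toReal_mono (by
      exact ENNReal.mul_ne_top ENNReal.ofReal_ne_top (ENNReal.mul_ne_top ENNReal.ofReal_ne_top
        (ENNReal.add_ne_top.2 ⟨hp.2.ne, hz.2.ne⟩))) h2
    rw [ENNReal.toReal_mul, ENNReal.toReal_mul, ENNReal.toReal_ofReal (by positivity),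
      ENNReal.toReal_ofReal hC.le, ENNReal.toReal_add hp.2.ne hz.2.ne] at h3
    rw [← hP, ← hZ] at h3
    refine h3.trans (le_of_eq ?_)
    field_simp
  have hpz : MemLp (fun x => p x + 2 * z x) 2 μ := hp.add (hz.const_mul 2)
  have hpzn : (eLpNorm (fun x => p x + 2 * z x) 2 μ).toReal ≤ P + 2 * Z := by
    have h1 : eLpNorm (fun x => p x + 2 * z x) 2 μ ≤
        eLpNorm p 2 μ + eLpNorm (fun x => 2 * z x) 2 μ :=
      eLpNorm_add_le hp.1 (hz.const_mul 2).1 (by norm_num)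
    have h2 : eLpNorm (fun x => 2 * z x) 2 μ = 2 * eLpNorm z 2 μ := by
      have := eLpNorm_const_smul (2 : ℝ) z 2 μ
      rwa [show ‖(2 : ℝ)‖ₑ = 2 by simp [enorm_eq_nnnorm]] at this
    rw [h2] at h1
    have h3 := ENNReal.toReal_mono (ENNReal.add_ne_top.2
      ⟨hp.2.ne, ENNReal.mul_ne_top (by norm_num) hz.2.ne⟩) h1
    rwa [ENNReal.toReal_add hp.2.ne (ENNReal.mul_ne_top (by norm_num) hz.2.ne),
      ENNReal.toReal_mul] at h3
  have ip : Integrable (fun x => lam * p x ^ 2) μ := hp.integrable_sq.const_mul lam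
  have imul : ∀ {g h : α → ℝ}, MemLp g 2 μ → MemLp h 2 μ → Integrable (fun x => g x * h x) μ :=
    fun hg hh => hg.integrable_mul hh
  have ipz := (imul hp hz).const_mul (2 * Lam)
  have if1 := imul hfv hpz
  have if2 := (imul hv hpz).const_mul T
  have key : ∫ x, lam * p x ^ 2 ∂μ ≤ ∫ x, (2 * Lam * (p x * z x) +
      (f₁ x * v x) * (p x + 2 * z x) + T * (v x * (p x + 2 * z x))) ∂μ + ∫ x, J x ∂μ := by
    have i3 : Integrable (fun x => 2 * Lam * (p x * z x) + (f₁ x * v x) * (p x + 2 * z x) +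
      T * (v x * (p x + 2 * z x))) μ := (ipz.add if1).add if2
    rw [← integral_add i3 hJ]
    refine integral_mono_ae ip (i3.add hJ) ?_
    filter_upwards [hf, hJle] with x h1 h2
    have h3 : f x * v x * (p x + 2 * z x) ≤ (f₁ x + T) * v x * (p x + 2 * z x) := by
      have := hp0 x
      have := hz0 x
      have := hv0 x
      gcongr
    linarith
  rw [integral_add_add ipz if1 if2, integral_const_mul, integral_const_mul, integral_const_mul,
    integral_sq_eq_eLpNorm_two hp] at key
  refine sq_le_of_absorb (Lam := Lam) hlam hT ?_
  have k1 : 2 * Lam * ∫ x, p x * z x ∂μ ≤ 2 * Lam * (P * Z) :=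
    mul_le_mul_of_nonneg_left (integral_mul_le_eLpNorm_two hp hz) (by positivity)
  have k2 : ∫ x, f₁ x * v x * (p x + 2 * z x) ∂μ ≤ lam / 3 * (P + Z) * (P + 2 * Z) :=
    (integral_mul_le_eLpNorm_two hfv hpz).trans
      (mul_le_mul hfvn hpzn ENNReal.toReal_nonneg (by positivity))
  have k3 : T * ∫ x, v x * (p x + 2 * z x) ∂μ ≤ T * W * (P + 2 * Z) := by
    rw [mul_assoc]
    exact mul_le_mul_of_nonneg_left ((integral_mul_le_eLpNorm_two hv hpz).trans
      (mul_le_mul_of_nonneg_left hpzn ENNReal.toReal_nonneg)) hT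
  linarith

/-! ### Interpolation and weak Lebesgue norms -/

/-- Hölder with exponents `(n+2)/(n-2)` and `(n+2)/4`. The power `4/(n+2)` is the one for which the
first factor becomes the Sobolev norm and the second the `L¹` norm. -/
theorem lintegral_interpolation {α : Type*} [MeasurableSpace α] {μ : Measure α} {n : ℕ}
    (hn : 3 ≤ n) {v w : α → ℝ} (hv : AEStronglyMeasurable v μ) (hw : AEStronglyMeasurable w μ) :
    ∫⁻ x, ‖v x‖ₑ ^ (2 - 4 / ((n : ℝ) + 2)) * ‖w x‖ₑ ^ (4 / ((n : ℝ) + 2)) ∂μ ≤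
      eLpNorm v (sobolevExponent n) μ ^ (2 - 4 / ((n : ℝ) + 2)) *
        (∫⁻ x, ‖w x‖ₑ ∂μ) ^ (4 / ((n : ℝ) + 2)) := by
  have hn' : (3 : ℝ) ≤ n := by exact_mod_cast hn
  have h2 : (0 : ℝ) < n - 2 := by linarith
  have hpq : (((n : ℝ) + 2) / (n - 2)).HolderConjugate ((n + 2) / 4) := by
    rw [Real.holderConjugate_iff]
    refine ⟨by rw [lt_div_iff₀ h2]; linarith, ?_⟩
    field_simp
    ring
  refine (ENNReal.lintegral_mul_le_Lp_mul_Lq μ hpq (hv.enorm.pow_const _)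
    (hw.enorm.pow_const _)).trans (le_of_eq ?_)
  have hs : sobolevExponent n ≠ 0 := by
    simp only [sobolevExponent, ne_eq, ENNReal.ofReal_eq_zero, not_le]
    positivity
  have hs' : sobolevExponent n ≠ ⊤ := ENNReal.ofReal_ne_top
  have hsr : (sobolevExponent n).toReal = 2 * (n : ℝ) / ((n : ℝ) - 2) :=
    ENNReal.toReal_ofReal (by positivity)
  rw [eLpNorm_eq_lintegral_rpow_enorm_toReal hs hs', hsr, ← ENNReal.rpow_mul]
  simp only [← ENNReal.rpow_mul]
  have e1 : (2 - 4 / ((n : ℝ) + 2)) * ((n + 2) / (n - 2)) = 2 * n / (n - 2) := by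
    field_simp
    ring
  have e2 : (4 / ((n : ℝ) + 2)) * ((n + 2) / 4) = 1 := by
    field_simp
  have e3 : 1 / (2 * (n : ℝ) / (n - 2)) * (2 - 4 / (n + 2)) = 1 / ((n + 2) / (n - 2)) := by
    field_simp
    ring
  have e4 : 1 / (((n : ℝ) + 2) / 4) = 4 / (n + 2) := by
    field_simp
  rw [e1, e2, e3, e4]
  simp

theorem sq_eLpNorm_le_interpolation {α : Type*} [MeasurableSpace α] {μ : Measure α} {n : ℕ}
    (hn : 3 ≤ n) {g v w : α → ℝ} {E : Set α} (hE : MeasurableSet E)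
    (hv : MemLp v (sobolevExponent n) μ) (hw : AEStronglyMeasurable w μ) {B L : ℝ} (hB : 0 ≤ B)
    (hL : 0 ≤ L) (hLE : ∫⁻ x in E, ‖w x‖ₑ ∂μ ≤ ENNReal.ofReal L) (hgE : ∀ x ∉ E, g x = 0)
    (hgle : ∀ x, g x ^ 2 ≤ B * (|v x| ^ (2 - 4 / ((n : ℝ) + 2)) * |w x| ^ (4 / ((n : ℝ) + 2)))) :
    (eLpNorm g 2 μ).toReal ^ 2 ≤ B *
      ((eLpNorm v (sobolevExponent n) μ).toReal ^ (2 - 4 / ((n : ℝ) + 2)) *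
        L ^ (4 / ((n : ℝ) + 2))) := by
  have hn' : (3 : ℝ) ≤ n := by exact_mod_cast hn
  have hσ : 0 < 4 / ((n : ℝ) + 2) := by positivity
  have hσ' : 0 < 2 - 4 / ((n : ℝ) + 2) := by
    have : 4 / ((n : ℝ) + 2) < 1 := by rw [div_lt_one (by positivity)]; linarith
    linarith
  set σ := 4 / ((n : ℝ) + 2) with hσdef
  have h1 : eLpNorm g 2 μ ^ (2 : ℝ) ≤ ENNReal.ofReal (B *
      ((eLpNorm v (sobolevExponent n) μ).toReal ^ (2 - σ) * L ^ σ)) := by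
    have h0 := eLpNorm_nnreal_pow_eq_lintegral (f := g) (μ := μ) (p := 2) (by norm_num)
    have h0' : eLpNorm g 2 μ ^ (2 : ℝ) = ∫⁻ x, ‖g x‖ₑ ^ (2 : ℝ) ∂μ := by simpa using h0
    rw [h0']
    have hwE : AEStronglyMeasurable (E.indicator w) μ := hw.indicator hE
    calc ∫⁻ x, ‖g x‖ₑ ^ (2 : ℝ) ∂μ
        ≤ ∫⁻ x, ENNReal.ofReal B * (‖v x‖ₑ ^ (2 - σ) * ‖E.indicator w x‖ₑ ^ σ) ∂μ := by
          refine lintegral_mono fun x => ?_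
          by_cases hx : x ∈ E
          · rw [Set.indicator_of_mem hx, ← ofReal_norm, ← ofReal_norm, ← ofReal_norm,
              ENNReal.ofReal_rpow_of_nonneg (norm_nonneg _) (by norm_num),
              ENNReal.ofReal_rpow_of_nonneg (norm_nonneg _) hσ'.le,
              ENNReal.ofReal_rpow_of_nonneg (norm_nonneg _) hσ.le,
              ← ENNReal.ofReal_mul (by positivity), ← ENNReal.ofReal_mul hB]
            refine ENNReal.ofReal_le_ofReal ?_
            simpa using hgle x
          · simp [hgE x hx]
      _ = ENNReal.ofReal B * ∫⁻ x, (‖v x‖ₑ ^ (2 - σ) * ‖E.indicator w x‖ₑ ^ σ) ∂μ :=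
          lintegral_const_mul' _ _ ENNReal.ofReal_ne_top
      _ ≤ ENNReal.ofReal B * (eLpNorm v (sobolevExponent n) μ ^ (2 - σ) *
            (∫⁻ x, ‖E.indicator w x‖ₑ ∂μ) ^ σ) := by
          gcongr
          exact lintegral_interpolation hn hv.1 hwE
      _ ≤ ENNReal.ofReal B * (ENNReal.ofReal ((eLpNorm v (sobolevExponent n) μ).toReal) ^ (2 - σ) *
            ENNReal.ofReal L ^ σ) := by
          rw [ENNReal.ofReal_toReal hv.2.ne]
          gcongr
          refine le_trans (le_of_eq ?_) hLE
          rw [← lintegral_indicator hE]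
          congr 1
          ext x
          by_cases hx : x ∈ E <;> simp [hx]
      _ = _ := by
          rw [ENNReal.ofReal_rpow_of_nonneg ENNReal.toReal_nonneg hσ'.le,
            ENNReal.ofReal_rpow_of_nonneg hL hσ.le, ← ENNReal.ofReal_mul (by positivity),
            ← ENNReal.ofReal_mul hB]
  have h2 := ENNReal.toReal_mono ENNReal.ofReal_ne_top h1
  rw [ENNReal.toReal_ofReal (by positivity), ← ENNReal.toReal_rpow] at h2
  simpa using h2

/-- Inserting `S² ≤ K Q` makes the right side a multiple of `Q^(n/(n+2))`. As this power is below
one, it can be divided out when `Q > 0`, and raising to the power `(n+2)/2` leaves `Q` on the left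
and `R²` on the right. -/
theorem le_of_interpolation {n : ℕ} (hn : 3 ≤ n) {Q S K B R : ℝ} (hQ : 0 ≤ Q) (hS : 0 ≤ S)
    (hK : 0 ≤ K) (hB : 0 ≤ B) (hR : 0 ≤ R) (hSQ : S ^ 2 ≤ K * Q)
    (hQS : Q ≤ B * (S ^ (2 - 4 / ((n : ℝ) + 2)) * R ^ (4 / ((n : ℝ) + 2)))) :
    Q ≤ (B * K ^ ((n : ℝ) / (n + 2))) ^ (((n : ℝ) + 2) / 2) * R ^ 2 := by
  have hn' : (3 : ℝ) ≤ n := by exact_mod_cast hn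
  rcases eq_or_lt_of_le hQ with h0 | h0
  · rw [← h0]; positivity
  have h1 : S ^ (2 - 4 / ((n : ℝ) + 2)) ≤ K ^ ((n : ℝ) / (n + 2)) * Q ^ ((n : ℝ) / (n + 2)) := by
    have e : S ^ (2 - 4 / ((n : ℝ) + 2)) = (S ^ 2) ^ ((n : ℝ) / (n + 2)) := by
      rw [← Real.rpow_natCast, ← Real.rpow_mul hS]
      congr 1
      push_cast
      field_simp
      ring
    rw [e, ← Real.mul_rpow hK hQ]
    exact Real.rpow_le_rpow (by positivity) hSQ (by positivity)
  have h2 : Q ^ ((n : ℝ) / (n + 2)) * Q ^ (2 / ((n : ℝ) + 2)) = Q := by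
    rw [← Real.rpow_add h0, ← add_div, div_self (by positivity), Real.rpow_one]
  have h3 : Q ^ (2 / ((n : ℝ) + 2)) ≤ B * K ^ ((n : ℝ) / (n + 2)) * R ^ (4 / ((n : ℝ) + 2)) := by
    have hQp : 0 < Q ^ ((n : ℝ) / (n + 2)) := Real.rpow_pos_of_pos h0 _
    refine le_of_mul_le_mul_left ?_ hQp
    rw [h2]
    refine hQS.trans ?_
    calc B * (S ^ (2 - 4 / ((n : ℝ) + 2)) * R ^ (4 / ((n : ℝ) + 2)))
        ≤ B * ((K ^ ((n : ℝ) / (n + 2)) * Q ^ ((n : ℝ) / (n + 2))) * R ^ (4 / ((n : ℝ) + 2))) := by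
          gcongr
      _ = _ := by ring
  have h4 := Real.rpow_le_rpow (by positivity) h3 (z := ((n : ℝ) + 2) / 2) (by positivity)
  rw [← Real.rpow_mul hQ, Real.mul_rpow (by positivity) (by positivity), ← Real.rpow_mul hR] at h4
  have e1 : 2 / ((n : ℝ) + 2) * ((n + 2) / 2) = 1 := by field_simp
  have e2 : 4 / ((n : ℝ) + 2) * ((n + 2) / 2) = (2 : ℕ) := by push_cast; field_simp; norm_num
  rwa [e1, e2, Real.rpow_one, Real.rpow_natCast] at h4

theorem measure_lt_of_weakLpNorm_le {n : ℕ} {F : Type*} [NormedAddCommGroup F] {U : Set (Rn n)}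
    {p N t : ℝ} {f : Rn n → F} (hp : 0 < p) (ht : 0 < t) (hN : 0 ≤ N)
    (h : weakLpNorm U p f ≤ ENNReal.ofReal N) :
    volume.restrict U {x | t < ‖f x‖} ≤ ENNReal.ofReal (N ^ p * t ^ (-p)) := by
  have h1 : ENNReal.ofReal t * (volume.restrict U {x | t < ‖f x‖}) ^ (1 / p) ≤
      ENNReal.ofReal N := by
    refine le_trans ?_ ((le_iSup _ t.toNNReal).trans h)
    have e : {x | t < ‖f x‖} = {x | ((t.toNNReal : ℝ≥0) : ℝ≥0∞) < ‖f x‖ₑ} := by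
      ext x
      rw [Set.mem_ofPred_eq, Set.mem_ofPred_eq, ← ofReal_norm]
      exact (ENNReal.ofReal_lt_ofReal_iff_of_nonneg ht.le).symm
    rw [e]
    rfl
  have h2 : (volume.restrict U {x | t < ‖f x‖}) ^ (1 / p) ≤ ENNReal.ofReal (N / t) := by
    rw [ENNReal.ofReal_div_of_pos ht, ENNReal.le_div_iff_mul_le (by simp [ht]) (by simp), mul_comm]
    exact h1
  have h3 := ENNReal.rpow_le_rpow h2 hp.le
  rw [← ENNReal.rpow_mul, one_div_mul_cancel hp.ne', ENNReal.rpow_one,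
    ENNReal.ofReal_rpow_of_nonneg (by positivity) hp.le] at h3
  rwa [Real.rpow_neg ht.le, ← div_eq_mul_inv, ← Real.div_rpow hN ht.le]

/-- Layer cake, split at height `τ`: below it the level sets are bounded by the measure of `E`,
above it by the weak norm, whose tail is integrable because `p > 1`. -/
theorem lintegral_le_of_weakLpNorm_le {n : ℕ} {U E : Set (Rn n)} {p N m τ : ℝ} {f : Rn n → ℝ}
    (hp : 1 < p) (hτ : 0 < τ) (hN : 0 ≤ N) (hm : 0 ≤ m) (hEU : E ⊆ U)
    (hEm : volume E ≤ ENNReal.ofReal m)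
    (hf : AEStronglyMeasurable f (volume.restrict U))
    (h : weakLpNorm U p f ≤ ENNReal.ofReal N) :
    ∫⁻ x in E, ‖f x‖ₑ ≤ ENNReal.ofReal (τ * m + N ^ p * (τ ^ (1 - p) / (p - 1))) := by
  have h1 : ∫⁻ x in E, ‖f x‖ₑ = ∫⁻ t in Set.Ioi (0 : ℝ), volume.restrict E {x | t < ‖f x‖} := by
    simp only [← ofReal_norm]
    exact lintegral_eq_lintegral_meas_lt _ (Eventually.of_forall fun x => norm_nonneg _)
      (hf.mono_set hEU).norm.aemeasurable
  rw [h1, ← Set.Ioc_union_Ioi_eq_Ioi hτ.le]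
  refine (lintegral_union_le _ _ _).trans ?_
  rw [ENNReal.ofReal_add (by positivity)
    (mul_nonneg (by positivity) (div_nonneg (by positivity) (by linarith)))]
  gcongr
  · calc ∫⁻ t in Set.Ioc 0 τ, volume.restrict E {x | t < ‖f x‖}
        ≤ ∫⁻ t in Set.Ioc 0 τ, ENNReal.ofReal m := by
          refine lintegral_mono fun t => ?_
          refine (measure_mono (Set.subset_univ _)).trans ?_
          rwa [Measure.restrict_apply_univ]
      _ = _ := by
          rw [lintegral_const, Measure.restrict_apply_univ, Real.volume_Ioc, sub_zero, mul_comm,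
            ENNReal.ofReal_mul hτ.le]
  · calc ∫⁻ t in Set.Ioi τ, volume.restrict E {x | t < ‖f x‖}
        ≤ ∫⁻ t in Set.Ioi τ, ENNReal.ofReal (N ^ p * t ^ (-p)) := by
          refine setLIntegral_mono' measurableSet_Ioi fun t ht => ?_
          exact (Measure.restrict_mono hEU le_rfl _).trans
            (measure_lt_of_weakLpNorm_le (by linarith) (hτ.trans ht) hN h)
      _ = ENNReal.ofReal (∫ t in Set.Ioi τ, N ^ p * t ^ (-p)) := by
          rw [ofReal_integral_eq_lintegral_ofReal]
          · exact (integrableOn_Ioi_rpow_of_lt (by linarith) hτ).const_mul _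
          · filter_upwards [ae_restrict_mem measurableSet_Ioi] with t ht
            have : 0 < t := hτ.trans ht
            positivity
      _ = _ := by
          rw [integral_const_mul, integral_Ioi_rpow_of_lt (by linarith) hτ]
          congr 2
          rw [show -p + 1 = 1 - p by ring, ← neg_sub p 1, div_neg, neg_div, neg_neg]

/-! ### Cut-off functions and approximation -/

theorem exists_cutoff (n : ℕ) : ∃ κ : ℝ, 0 ≤ κ ∧ ∀ (x₀ : Rn n) (r : ℝ), 0 < r →
    ∃ η : Rn n → ℝ, ContDiff ℝ ∞ η ∧ (∀ x, 0 ≤ η x) ∧ (∀ x, η x ≤ 1) ∧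
      (∀ x ∈ Metric.closedBall x₀ r, η x = 0) ∧ (∀ x ∉ Metric.closedBall x₀ (2 * r), η x = 1) ∧
      (∀ x, ‖gradient η x‖ ≤ κ / r) ∧
      (∀ x ∉ Metric.closedBall x₀ (2 * r), gradient η x = 0) := by
  obtain ⟨χ, hχ, h0, h1, h2, h3⟩ := exists_isTestFunction_eq_one (0 : Rn n)
  obtain ⟨κ, hκ⟩ := (hasCompactSupport_gradient hχ.2.1).exists_bound_of_continuous
    (continuous_gradient hχ.1)
  refine ⟨κ, (norm_nonneg _).trans (hκ 0), fun x₀ r hr => ?_⟩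
  have hsm : ContDiff ℝ ∞ fun x : Rn n => r⁻¹ • (x - x₀) :=
    (contDiff_id.sub contDiff_const).const_smul r⁻¹
  have hone : ∀ x ∉ Metric.closedBall x₀ (2 * r), 1 - χ (r⁻¹ • (x - x₀)) = 1 := by
    intro x hx
    have : r⁻¹ • (x - x₀) ∉ Function.support χ := by
      rw [h3, mem_ball_zero_iff, norm_smul, norm_inv, Real.norm_of_nonneg hr.le, not_lt,
        inv_mul_eq_div, le_div_iff₀ hr]
      rw [mem_closedBall_iff_norm, not_le] at hx
      exact hx.le
    rw [Function.notMem_support.1 this, sub_zero]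
  refine ⟨fun x => 1 - χ (r⁻¹ • (x - x₀)), contDiff_const.sub (hχ.1.comp hsm), fun x => ?_,
    fun x => ?_, fun x hx => ?_, hone, fun x => ?_, fun x hx => ?_⟩
  · linarith [h1 (r⁻¹ • (x - x₀))]
  · linarith [h0 (r⁻¹ • (x - x₀))]
  · change 1 - χ (r⁻¹ • (x - x₀)) = 0
    rw [h2, sub_self]
    rw [mem_closedBall_zero_iff, norm_smul, norm_inv, Real.norm_of_nonneg hr.le,
      inv_mul_eq_div, div_le_iff₀ hr, one_mul]
    exact mem_closedBall_iff_norm.1 hx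
  · rw [norm_gradient]
    have hd : HasFDerivAt (fun y : Rn n => 1 - χ (r⁻¹ • (y - x₀)))
        (-((fderiv ℝ χ (r⁻¹ • (x - x₀))).comp (r⁻¹ • ContinuousLinearMap.id ℝ (Rn n)))) x := by
      have h4 : HasFDerivAt (fun y : Rn n => r⁻¹ • (y - x₀))
          (r⁻¹ • ContinuousLinearMap.id ℝ (Rn n)) x :=
        ((hasFDerivAt_id x).sub_const x₀).const_smul r⁻¹
      exact ((hχ.differentiable _).hasFDerivAt.comp x h4).const_sub 1
    rw [hd.fderiv, norm_neg]
    refine (ContinuousLinearMap.opNorm_comp_le _ _).trans ?_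
    rw [norm_smul, norm_inv, Real.norm_of_nonneg hr.le, ← norm_gradient, div_eq_mul_inv]
    refine mul_le_mul (hκ _) ?_ (by positivity) ((norm_nonneg _).trans (hκ 0))
    exact mul_le_of_le_one_right (by positivity) ContinuousLinearMap.norm_id_le
  · have he : (fun x => 1 - χ (r⁻¹ • (x - x₀))) =ᶠ[𝓝 x] fun _ => 1 := by
      filter_upwards [Metric.isClosed_closedBall.isOpen_compl.mem_nhds hx] with y hy
      exact hone y hy
    rw [he.gradient_eq, gradient_fun_const]

theorem sobolev_limit {n : ℕ} (hn : 3 ≤ n) {U : Set (Rn n)} (hU : IsOpen U)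
    {F : ℕ → Rn n → ℝ} {f : Rn n → ℝ} {g : Rn n → Rn n} (hF : ∀ k, IsTestFunction U (F k))
    (hf : LpTendsto 2 (volume.restrict U) F f)
    (hg : LpTendsto 2 (volume.restrict U) (fun k => gradient (F k)) g) :
    eLpNorm f (sobolevExponent n) (volume.restrict U) ≤
      ENNReal.ofReal (sobolevConst n) * eLpNorm g 2 (volume.restrict U) := by
  refine eLpNorm_le_liminf_of_tendsto (p := 2) (by norm_num) (fun k => (hf.memLp k).1)
    hf.memLp_lim.1 hf.tendsto
    (K := fun k => ENNReal.ofReal (sobolevConst n) * (eLpNorm g 2 (volume.restrict U) +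
      eLpNorm (fun x => gradient (F k) x - g x) 2 (volume.restrict U))) (fun k => ?_) ?_
  · refine (eLpNorm_le_gradient_restrict hn hU (hF k)).trans ?_
    gcongr
    have := eLpNorm_add_le (p := 2) hg.memLp_lim.1 ((hg.memLp k).sub hg.memLp_lim).1 (by norm_num)
    rwa [add_sub_cancel] at this
  · have h := ENNReal.Tendsto.const_mul (a := ENNReal.ofReal (sobolevConst n))
      (hg.tendsto.const_add (eLpNorm g 2 (volume.restrict U))) (Or.inr ENNReal.ofReal_ne_top)
    rwa [add_zero] at h

theorem LpTendsto.const_sub {α E : Type*} [MeasurableSpace α] [NormedAddCommGroup E] {p : ℝ≥0∞}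
    {μ : Measure α} {F : ℕ → α → E} {f g : α → E} (hg : MemLp g p μ) (hF : LpTendsto p μ F f) :
    LpTendsto p μ (fun k x => g x - F k x) (fun x => g x - f x) := by
  refine ⟨fun k => hg.sub (hF.memLp k), hg.sub hF.memLp_lim, hF.tendsto.congr fun k => ?_⟩
  refine eLpNorm_congr_norm_ae (Eventually.of_forall fun x => ?_)
  rw [sub_sub_sub_cancel_left, norm_sub_rev]

/-- Sobolev's inequality for `φ k - φ j`, with `j` tending to infinity, bounds `φ k - w`. Hence the
sequence that converges in `W^{1,2}` also converges in the Sobolev exponent. -/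
theorem MemW01p.exists_approx {n : ℕ} (hn : 3 ≤ n) {U : Set (Rn n)} (hU : IsOpen U)
    {w : Rn n → ℝ} {Dw : Rn n → Rn n} (h : MemW01p U 2 w Dw) :
    ∃ φ : ℕ → Rn n → ℝ, (∀ k, IsTestFunction U (φ k)) ∧
      LpTendsto 2 (volume.restrict U) φ w ∧
      LpTendsto 2 (volume.restrict U) (fun k => gradient (φ k)) Dw ∧
      LpTendsto (sobolevExponent n) (volume.restrict U) φ w := by
  obtain ⟨⟨hw, hDw, -⟩, φ, hφ, h1, h2⟩ := h
  have T1 : LpTendsto 2 (volume.restrict U) φ w :=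
    ⟨fun k => (hφ k).memLp _ _, hw, h1.congr fun k =>
      eLpNorm_congr_norm_ae (Eventually.of_forall fun x => norm_sub_rev _ _)⟩
  have T2 : LpTendsto 2 (volume.restrict U) (fun k => gradient (φ k)) Dw :=
    ⟨fun k => (hφ k).memLp_gradient _ _, hDw, h2.congr fun k =>
      eLpNorm_congr_norm_ae (Eventually.of_forall fun x => norm_sub_rev _ _)⟩
  have key : ∀ k, eLpNorm (fun x => φ k x - w x) (sobolevExponent n) (volume.restrict U) ≤
      ENNReal.ofReal (sobolevConst n) *
        eLpNorm (fun x => gradient (φ k) x - Dw x) 2 (volume.restrict U) := fun k => by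
    refine sobolev_limit hn hU (F := fun j x => φ k x - φ j x) (fun j => (hφ k).sub (hφ j))
      (T1.const_sub (T1.memLp k)) ?_
    convert T2.const_sub (T2.memLp k) using 3 with j x
    exact gradient_sub_apply (hφ k).differentiable.differentiableAt
      (hφ j).differentiable.differentiableAt
  have hmem : ∀ k, MemLp (fun x => φ k x - w x) (sobolevExponent n) (volume.restrict U) :=
    fun k => ⟨((T1.memLp k).sub T1.memLp_lim).1, (key k).trans_lt
      (ENNReal.mul_lt_top ENNReal.ofReal_lt_top ((T2.memLp k).sub T2.memLp_lim).2)⟩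
  refine ⟨φ, hφ, T1, T2, fun k => (hφ k).memLp _ _, ?_, ?_⟩
  · have := ((hφ 0).memLp (sobolevExponent n) (volume.restrict U)).sub (hmem 0)
    exact this.ae_eq (Eventually.of_forall fun x => sub_sub_cancel (φ 0 x) (w x))
  · have h0 := ENNReal.Tendsto.const_mul (a := ENNReal.ofReal (sobolevConst n)) T2.tendsto
      (Or.inr ENNReal.ofReal_ne_top)
    rw [mul_zero] at h0
    exact tendsto_of_tendsto_of_tendsto_of_le_of_le tendsto_const_nhds h0 (fun _ => zero_le) key

theorem IsTestFunction.integrable_smul {n : ℕ} {V : Set (Rn n)} {φ : Rn n → ℝ} {g : Rn n → Rn n}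
    (hφ : IsTestFunction V φ) (hg : LocallyIntegrableOn g V volume) :
    Integrable (fun x => φ x • g x) (volume.restrict V) := by
  have h1 : IntegrableOn g (tsupport φ) volume := hg.integrableOn_compact_subset hφ.2.2 hφ.2.1
  have h2 : IntegrableOn (fun x => φ x • g x) (tsupport φ) volume :=
    h1.continuousOn_smul hφ.1.continuous.continuousOn hφ.2.1
  refine ((integrableOn_iff_integrable_of_support_subset fun x hx => ?_).1 h2).integrableOn
  refine subset_tsupport φ fun h0 => hx ?_
  simp only [h0, zero_smul]

/-- Weak gradients are local and unique. This is needed since `VanishesOnBoundaryAwayFrom` compares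
only the functions, not their gradients. -/
theorem HasWeakGradient.ae_eq {n : ℕ} {U V : Set (Rn n)} (hU : IsOpen U) (hV : IsOpen V)
    (hVU : V ⊆ U) {u w : Rn n → ℝ} {Du Dw : Rn n → Rn n} (hu : HasWeakGradient V u Du)
    (hw : HasWeakGradient U w Dw) (h : ∀ᵐ x ∂(volume.restrict V), w x = u x) :
    ∀ᵐ x ∂(volume.restrict V), Dw x = Du x := by
  have hDw := hw.2.1.mono_set hVU
  have key := hV.ae_eq_zero_of_integral_contDiff_smul_eq_zero (μ := volume)
    (f := fun x => Dw x - Du x) (hDw.sub hu.2.1) fun g hg1 hg2 hg3 => ?_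
  · rw [ae_restrict_iff' hV.measurableSet]
    filter_upwards [key] with x hx hxV
    exact sub_eq_zero.1 (hx hxV)
  · have hg : IsTestFunction V g := ⟨hg1, hg2, hg3⟩
    have hz : ∀ x ∉ V, g x = 0 := fun x hx => image_eq_zero_of_notMem_tsupport fun h => hx (hg3 h)
    have hz' : ∀ x ∉ V, gradient g x = 0 := fun x hx => by
      have : fderiv ℝ g x = 0 := by
        by_contra h0
        exact hx (hg3 (support_fderiv_subset ℝ h0))
      simp [gradient, this]
    have e1 := hu.2.2 g hg
    have e2 := hw.2.2 g (hg.mono hVU)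
    have s1 : ∫ x in U, w x • gradient g x = ∫ x in V, w x • gradient g x :=
      setIntegral_eq_of_subset_of_forall_sdiff_eq_zero hU.measurableSet hVU
        fun x hx => by rw [hz' x hx.2, smul_zero]
    have s2 : ∫ x in U, g x • Dw x = ∫ x in V, g x • Dw x :=
      setIntegral_eq_of_subset_of_forall_sdiff_eq_zero hU.measurableSet hVU
        fun x hx => by rw [hz x hx.2, zero_smul]
    have s3 : ∫ x in V, w x • gradient g x = ∫ x in V, u x • gradient g x := by
      refine integral_congr_ae ?_
      filter_upwards [h] with x hx
      rw [hx]
    have i1 : Integrable (fun x => g x • Dw x) (volume.restrict V) := hg.integrable_smul hDw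
    have i2 : Integrable (fun x => g x • Du x) (volume.restrict V) := hg.integrable_smul hu.2.1
    rw [← setIntegral_eq_integral_of_forall_compl_eq_zero (s := V)
      fun x hx => by rw [hz x hx, zero_smul]]
    simp only [smul_sub]
    rw [integral_sub i1 i2, ← s2, ← neg_eq_iff_eq_neg.2 e1, ← neg_eq_iff_eq_neg.2 e2, s1, s3,
      sub_self]

theorem exists_upperTail_lt {n : ℕ} {U : Set (Rn n)} {f : Rn n → Rn n} {ε ρ : ℝ} (hε : 0 < ε)
    (hf : MemLp f (n : ℝ≥0∞) (volume.restrict U)) (hρ : tailLevel U f ε ≤ ρ) :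
    ∃ t : ℝ, 0 < t ∧ t ≤ |ρ| + 1 ∧ upperTail U f t < ENNReal.ofReal ε := by
  -- The tail of a fixed `L^n` function tends to zero, so the infimum `tailLevel` is over a nonempty
  -- set and is not the default value of `sInf`.
  have hne : {t : ℝ | 0 < t ∧ upperTail U f t < ENNReal.ofReal ε}.Nonempty := by
    obtain ⟨g, hg, hfg⟩ := hf.1
    obtain ⟨M, hM⟩ := (hf.ae_eq hfg).eLpNorm_indicator_norm_ge_le hg (half_pos hε)
    refine ⟨max M 1, by positivity, ?_⟩
    refine lt_of_le_of_lt (b := eLpNorm ({x | M ≤ (‖g x‖₊ : ℝ)}.indicator g) n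
      (volume.restrict U)) ?_ (hM.trans_lt
      ((ENNReal.ofReal_lt_ofReal_iff hε).2 (half_lt_self hε)))
    refine eLpNorm_mono_ae ?_
    filter_upwards [hfg] with x hx
    by_cases h1 : max M 1 ≤ ‖f x‖
    · have h2 : M ≤ ‖g x‖ := hx ▸ (le_max_left M 1).trans h1
      rw [Set.indicator_of_mem (show x ∈ {x | max M 1 ≤ ‖f x‖} from h1),
        Set.indicator_of_mem (show x ∈ {x | M ≤ (‖g x‖₊ : ℝ)} from h2), hx]
    · rw [Set.indicator_of_notMem (show x ∉ {x | max M 1 ≤ ‖f x‖} from h1), norm_zero]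
      exact norm_nonneg _
  obtain ⟨t, ht, htρ⟩ := exists_lt_of_csInf_lt hne
    (lt_of_le_of_lt (hρ.trans (le_abs_self ρ)) (lt_add_one _))
  exact ⟨t, ht.1, htρ.le, ht.2⟩

/-! ### The Caccioppoli inequality away from the pole -/

theorem energy_pointwise_left {E : Type*} [NormedAddCommGroup E] [InnerProductSpace ℝ E]
    {lam Lam ζ w : ℝ} {A : E →L[ℝ] E} {f Dw Dζ : E} (hζ : 0 ≤ ζ) (hA : ‖A‖ ≤ Lam)
    (hell : lam * ‖Dw‖ ^ 2 ≤ inner ℝ (A Dw) Dw) :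
    -- The summand `2 (|w| * ‖Dζ‖)` in the drift term is not needed in this case; it gives both sign
    -- conditions the same lower bound.
    lam * (ζ * ‖Dw‖) ^ 2 - 2 * Lam * ((ζ * ‖Dw‖) * (|w| * ‖Dζ‖)) -
        ‖f‖ * (ζ * |w|) * (ζ * ‖Dw‖ + 2 * (|w| * ‖Dζ‖)) ≤
      inner ℝ (A Dw) (ζ • ζ • Dw + (2 : ℝ) • ζ • w • Dζ) - inner ℝ f Dw * (ζ * ζ * w) := by
  have h1 : |inner ℝ (A Dw) Dζ| ≤ Lam * ‖Dw‖ * ‖Dζ‖ :=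
    (abs_real_inner_le_norm _ _).trans
      (mul_le_mul_of_nonneg_right (A.le_of_opNorm_le hA Dw) (norm_nonneg _))
  have h2 : |inner ℝ f Dw| ≤ ‖f‖ * ‖Dw‖ := abs_real_inner_le_norm _ _
  have h3 : -(|inner ℝ (A Dw) Dζ| * |w|) ≤ inner ℝ (A Dw) Dζ * w := by
    rw [← abs_mul]; exact neg_abs_le _
  have h4 : inner ℝ f Dw * w ≤ |inner ℝ f Dw| * |w| := by
    rw [← abs_mul]; exact le_abs_self _
  have h5 := mul_le_mul_of_nonneg_right h1 (abs_nonneg w)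
  have h6 := mul_le_mul_of_nonneg_right h2 (abs_nonneg w)
  have h7 : 0 ≤ ‖f‖ * (ζ * |w|) * (2 * (|w| * ‖Dζ‖)) := by positivity
  have h8 := mul_le_mul_of_nonneg_left hell (mul_nonneg hζ hζ)
  have h9 := mul_le_mul_of_nonneg_left ((neg_le_neg h5).trans h3) hζ
  have h10 := mul_le_mul_of_nonneg_left (h4.trans h6) (mul_nonneg hζ hζ)
  simp only [inner_add_right, inner_smul_right]
  linarith

theorem energy_pointwise_right {E : Type*} [NormedAddCommGroup E] [InnerProductSpace ℝ E]
    {lam Lam ζ w : ℝ} {A : E →L[ℝ] E} {f Dw Dζ : E} (hζ : 0 ≤ ζ) (hA : ‖A‖ ≤ Lam)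
    (hell : lam * ‖Dw‖ ^ 2 ≤ inner ℝ (A Dw) Dw) :
    lam * (ζ * ‖Dw‖) ^ 2 - 2 * Lam * ((ζ * ‖Dw‖) * (|w| * ‖Dζ‖)) -
        ‖f‖ * (ζ * |w|) * (ζ * ‖Dw‖ + 2 * (|w| * ‖Dζ‖)) ≤
      inner ℝ (A Dw) (ζ • ζ • Dw + (2 : ℝ) • ζ • w • Dζ) +
        inner ℝ f (ζ • ζ • Dw + (2 : ℝ) • ζ • w • Dζ) * w := by
  have h1 : |inner ℝ (A Dw) Dζ| ≤ Lam * ‖Dw‖ * ‖Dζ‖ :=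
    (abs_real_inner_le_norm _ _).trans
      (mul_le_mul_of_nonneg_right (A.le_of_opNorm_le hA Dw) (norm_nonneg _))
  have h3 : -(|inner ℝ (A Dw) Dζ| * |w|) ≤ inner ℝ (A Dw) Dζ * w := by
    rw [← abs_mul]; exact neg_abs_le _
  have h5 := mul_le_mul_of_nonneg_right h1 (abs_nonneg w)
  have h8 := mul_le_mul_of_nonneg_left hell (mul_nonneg hζ hζ)
  have h9 := mul_le_mul_of_nonneg_left ((neg_le_neg h5).trans h3) hζ
  have h11 : ‖ζ • ζ • Dw + (2 : ℝ) • ζ • w • Dζ‖ ≤ ζ * (ζ * ‖Dw‖ + 2 * (|w| * ‖Dζ‖)) := by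
    refine (norm_add_le _ _).trans (le_of_eq ?_)
    simp only [norm_smul, Real.norm_eq_abs, abs_of_nonneg hζ, abs_two]
    ring
  have h12 : -(‖f‖ * (ζ * (ζ * ‖Dw‖ + 2 * (|w| * ‖Dζ‖))) * |w|) ≤
      inner ℝ f (ζ • ζ • Dw + (2 : ℝ) • ζ • w • Dζ) * w := by
    refine (neg_le_neg ?_).trans (neg_abs_le _)
    rw [abs_mul]
    exact mul_le_mul_of_nonneg_right ((abs_real_inner_le_norm _ _).trans
      (mul_le_mul_of_nonneg_left h11 (norm_nonneg _))) (abs_nonneg _)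
  have h13 : inner ℝ (A Dw) (ζ • ζ • Dw + (2 : ℝ) • ζ • w • Dζ) =
      ζ * ζ * inner ℝ (A Dw) Dw + 2 * (ζ * (inner ℝ (A Dw) Dζ * w)) := by
    simp only [inner_add_right, inner_smul_right]
    ring
  rw [h13]
  linarith

theorem gradient_cutoff_sq {n : ℕ} {ζ φ : Rn n → ℝ} (hζ : ContDiff ℝ ∞ ζ) (hφ : ContDiff ℝ ∞ φ)
    (x : Rn n) : gradient (fun y => ζ y * (ζ y * φ y)) x =
      ζ x • ζ x • gradient φ x + (2 : ℝ) • ζ x • φ x • gradient ζ x := by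
  have h1 : DifferentiableAt ℝ ζ x := (hζ.differentiable (by simp)).differentiableAt
  have h2 : DifferentiableAt ℝ φ x := (hφ.differentiable (by simp)).differentiableAt
  rw [gradient_mul_apply h1 (h1.fun_mul h2), gradient_mul_apply h1 h2]
  module

theorem caccioppoli {n : ℕ} (hn : 3 ≤ n) {lam Lam ρ : ℝ} (hlam : 0 < lam) {Ω : Set (Rn n)}
    {A : Rn n → Rn n →L[ℝ] Rn n} {b c : Rn n → Rn n} {d : Rn n → ℝ} {x₀ : Rn n}
    {u w ζ : Rn n → ℝ} {Du Dw : Rn n → Rn n} {r κ : ℝ} {φ : ℕ → Rn n → ℝ}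
    (hΩ : IsOpen Ω) (hA : AEStronglyMeasurable A (volume.restrict Ω))
    (hAb : ∀ᵐ x ∂(volume.restrict Ω), ‖A x‖ ≤ Lam)
    (hell : ∀ᵐ x ∂(volume.restrict Ω), ∀ ξ : Rn n, lam * ‖ξ‖ ^ 2 ≤ inner ℝ (A x ξ) ξ)
    (hb : MemLp b (n : ℝ≥0∞) (volume.restrict Ω)) (hc : MemLp c (n : ℝ≥0∞) (volume.restrict Ω))
    (hd : MemLp d ((n : ℝ≥0∞) / 2) (volume.restrict Ω)) (hdiv : GeDiv Ω d b ∨ GeDiv Ω d c)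
    (hρ : tailLevel Ω (fun x => b x - c x) (lam / (3 * sobolevConst n)) ≤ ρ)
    (hu : IsWeakSolution (Ω \ {x₀}) A b c d u Du) (hr : 0 < r)
    (hφ : ∀ k, IsTestFunction Ω (φ k)) (hφw : LpTendsto 2 (volume.restrict Ω) φ w)
    (hφD : LpTendsto 2 (volume.restrict Ω) (fun k => gradient (φ k)) Dw)
    (hφs : LpTendsto (sobolevExponent n) (volume.restrict Ω) φ w)
    (hwu : ∀ᵐ x ∂(volume.restrict Ω), x ∉ Metric.closedBall x₀ r → w x = u x ∧ Dw x = Du x)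
    (hζ : ContDiff ℝ ∞ ζ) (hζ0 : ∀ x, 0 ≤ ζ x) (hζ1 : ∀ x, ζ x ≤ 1)
    (hζκ : ∀ x, ‖gradient ζ x‖ ≤ κ) (hζr : ∀ x ∈ Metric.closedBall x₀ r, ζ x = 0) :
    (eLpNorm (fun x => ζ x * ‖Dw x‖) 2 (volume.restrict Ω)).toReal ^ 2 ≤
      caccioppoliConst lam |Lam| (|ρ| + 1) *
        ((eLpNorm (fun x => |w x| * ‖gradient ζ x‖) 2 (volume.restrict Ω)).toReal ^ 2 +
          (eLpNorm (fun x => ζ x * |w x|) 2 (volume.restrict Ω)).toReal ^ 2) ∧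
    (eLpNorm (fun x => ζ x * |w x|) (sobolevExponent n) (volume.restrict Ω)).toReal ≤
      sobolevConst n * ((eLpNorm (fun x => ζ x * ‖Dw x‖) 2 (volume.restrict Ω)).toReal +
        (eLpNorm (fun x => |w x| * ‖gradient ζ x‖) 2 (volume.restrict Ω)).toReal) := by
  have hC := sobolevConst_pos hn
  have := holderTriple_sobolevExponent hn
  set μ := volume.restrict Ω with hμ
  have hζm : MemLp ζ ⊤ μ := memLp_top_of_bound hζ.continuous.aestronglyMeasurable 1
    (Eventually.of_forall fun x => by rw [Real.norm_of_nonneg (hζ0 x)]; exact hζ1 x)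
  have hDζm : MemLp (gradient ζ) ⊤ μ :=
    memLp_top_of_bound (continuous_gradient hζ).aestronglyMeasurable κ (Eventually.of_forall hζκ)
  have hV : MemLp (fun x => A x (Dw x)) 2 μ := memLp_clm_apply hA hAb hφD.memLp_lim
  have hp : MemLp (fun x => ζ x * ‖Dw x‖) 2 μ := hφD.memLp_lim.norm.mul' (p := ⊤) (r := 2) hζm
  have hz : MemLp (fun x => |w x| * ‖gradient ζ x‖) 2 μ :=
    hDζm.norm.mul' (p := 2) (r := 2) hφw.memLp_lim.norm
  have hv : MemLp (fun x => ζ x * |w x|) 2 μ :=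
    hφw.memLp_lim.norm.mul' (p := ⊤) (r := 2) hζm
  have hvs : MemLp (fun x => ζ x * |w x|) (sobolevExponent n) μ :=
    hφs.memLp_lim.norm.mul' (p := ⊤) (r := sobolevExponent n) hζm
  have hsob : eLpNorm (fun x => ζ x * |w x|) (sobolevExponent n) μ ≤
      ENNReal.ofReal (sobolevConst n) * (eLpNorm (fun x => ζ x * ‖Dw x‖) 2 μ +
        eLpNorm (fun x => |w x| * ‖gradient ζ x‖) 2 μ) := by
    have T1 : LpTendsto 2 μ (fun k x => ζ x * φ k x) (fun x => ζ x * w x) := hφw.const_smul hζm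
    have T2 : LpTendsto 2 μ (fun k x => ζ x • gradient (φ k) x + φ k x • gradient ζ x)
        (fun x => ζ x • Dw x + w x • gradient ζ x) := by
      have t1 : LpTendsto 2 μ _ _ := hφD.const_smul hζm
      exact t1.add (by norm_num) (hφw.smul_const hDζm)
    have h1 := sobolev_limit hn hΩ (fun k => (hφ k).mul_left hζ) T1 (by
      convert T2 using 3 with k x
      exact gradient_mul_apply (hζ.differentiable (by simp)).differentiableAt
        (hφ k).differentiable.differentiableAt)
    have h2 : eLpNorm (fun x => ζ x * |w x|) (sobolevExponent n) μ =
        eLpNorm (fun x => ζ x * w x) (sobolevExponent n) μ :=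
      eLpNorm_congr_norm_ae (Eventually.of_forall fun x => by simp)
    rw [h2]
    refine h1.trans ?_
    gcongr
    have t1 : LpTendsto 2 μ _ _ := hφD.const_smul hζm
    have t2 : LpTendsto 2 μ _ _ := hφw.smul_const (r := 2) hDζm
    refine (eLpNorm_add_le t1.memLp_lim.1 t2.memLp_lim.1 (by norm_num)).trans (le_of_eq ?_)
    congr 1 <;> refine eLpNorm_congr_norm_ae (Eventually.of_forall fun x => ?_) <;>
      simp [norm_smul]
  refine ⟨?_, ?_⟩
  swap
  · have h3 := ENNReal.toReal_mono (ENNReal.mul_ne_top ENNReal.ofReal_ne_top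
      (ENNReal.add_ne_top.2 ⟨hp.2.ne, hz.2.ne⟩)) hsob
    rwa [ENNReal.toReal_mul, ENNReal.toReal_ofReal hC.le,
      ENNReal.toReal_add hp.2.ne hz.2.ne] at h3
  have hζsupp : tsupport ζ ⊆ (Metric.ball x₀ r)ᶜ :=
    closure_minimal (fun x hx hxb => hx (hζr x (Metric.ball_subset_closedBall hxb)))
      Metric.isOpen_ball.isClosed_compl
  -- Since `ζ` vanishes on a whole ball, the closed support stays away from the pole and the
  -- equation in the punctured domain may be tested.
  have htest : ∀ k, IsTestFunction (Ω \ {x₀}) (fun x => ζ x * (ζ x * φ k x)) := fun k => by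
    have h1 := ((hφ k).mul_left hζ).mul_left hζ
    refine ⟨h1.1, h1.2.1, fun x hx => ⟨h1.2.2 hx, fun hx0 => ?_⟩⟩
    have h2 := hζsupp (tsupport_mul_subset_left hx)
    rw [Set.mem_singleton_iff.1 hx0] at h2
    exact h2 (Metric.mem_ball_self hr)
  have hweak : ∀ k, ∫ x, (inner ℝ (A x (Dw x))
        (ζ x • ζ x • gradient (φ k) x + (2 : ℝ) • ζ x • φ k x • gradient ζ x)
      + inner ℝ (b x) (ζ x • ζ x • gradient (φ k) x + (2 : ℝ) • ζ x • φ k x • gradient ζ x) * w x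
      + inner ℝ (c x) (Dw x) * (ζ x * ζ x * φ k x) + d x * w x * (ζ x * ζ x * φ k x)) ∂μ = 0 := by
    intro k
    have h1 := hu _ (htest k)
    have : NeZero n := ⟨by omega⟩
    have h2 : volume.restrict (Ω \ {x₀}) = μ :=
      Measure.restrict_congr_set (sdiff_null_ae_eq_self (measure_singleton x₀))
    rw [h2] at h1
    rw [← h1]
    refine integral_congr_ae ?_
    filter_upwards [hwu] with x hx
    rw [gradient_cutoff_sq hζ (hφ k).1]
    by_cases hxr : x ∈ Metric.closedBall x₀ r
    · simp [hζr x hxr]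
    · rw [(hx hxr).1, (hx hxr).2, mul_assoc (ζ x) (ζ x)]
  have hgediv : ∀ e : Rn n → Rn n, GeDiv Ω d e → ∀ k, 0 ≤ ∫ x, (inner ℝ (e x)
      (φ k x • (ζ x • ζ x • gradient (φ k) x + (2 : ℝ) • ζ x • φ k x • gradient ζ x)
        + (ζ x * ζ x * φ k x) • gradient (φ k) x) + d x * (ζ x * ζ x * φ k x * φ k x)) ∂μ := by
    intro e he k
    have ht := ((hφ k).mul_left hζ).mul_left hζ
    have h1 := he _ (ht.mul_left (hφ k).1) fun x => by
      have : φ k x * (ζ x * (ζ x * φ k x)) = (ζ x * φ k x) ^ 2 := by ring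
      rw [this]
      positivity
    refine h1.trans (le_of_eq (integral_congr_ae (Eventually.of_forall fun x => ?_)))
    simp only
    rw [gradient_mul_apply (hφ k).differentiable.differentiableAt ht.differentiable.differentiableAt,
      gradient_cutoff_sq hζ (hφ k).1, mul_assoc (ζ x) (ζ x) (φ k x)]
    ring_nf
  obtain ⟨t, ht0, htρ, htail⟩ := exists_upperTail_lt (by positivity) (hb.sub hc) hρ
  have hfm : AEStronglyMeasurable (fun x => b x - c x) μ := (hb.sub hc).1
  have hnull : NullMeasurableSet {x | t ≤ ‖b x - c x‖} μ :=
    nullMeasurableSet_le aemeasurable_const hfm.norm.aemeasurable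
  have hf₁ : MemLp ({x | t ≤ ‖b x - c x‖}.indicator fun x => ‖b x - c x‖) n μ := by
    refine (hb.sub hc).of_le (hfm.norm.indicator₀ hnull) (Eventually.of_forall fun x => ?_)
    refine (norm_indicator_le_norm_self _ _).trans (le_of_eq ?_)
    simp
  have hf₁n : eLpNorm ({x | t ≤ ‖b x - c x‖}.indicator fun x => ‖b x - c x‖) n μ ≤
      ENNReal.ofReal (lam / (3 * sobolevConst n)) := by
    refine le_trans (le_of_eq ?_) htail.le
    refine eLpNorm_congr_norm_ae (Eventually.of_forall fun x => ?_)
    rw [norm_indicator_eq_indicator_norm, norm_indicator_eq_indicator_norm]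
    simp
  have hfle : ∀ x, ‖b x - c x‖ ≤
      ({x | t ≤ ‖b x - c x‖}.indicator fun x => ‖b x - c x‖) x + (|ρ| + 1) := fun x => by
    by_cases hx : x ∈ {x | t ≤ ‖b x - c x‖}
    · rw [Set.indicator_of_mem hx]
      linarith [abs_nonneg ρ]
    · rw [Set.indicator_of_notMem hx, zero_add]
      exact (not_le.1 hx).le.trans htρ
  have hp0 : ∀ x, 0 ≤ ζ x * ‖Dw x‖ := fun x => mul_nonneg (hζ0 x) (norm_nonneg _)
  have hz0 : ∀ x, 0 ≤ |w x| * ‖gradient ζ x‖ := fun x => by positivity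
  have hv0 : ∀ x, 0 ≤ ζ x * |w x| := fun x => mul_nonneg (hζ0 x) (abs_nonneg _)
  rcases hdiv with hdiv | hdiv
  · obtain ⟨hJ, hJ0⟩ := energy_inequality_left (s := sobolevExponent n) hV hb hc hd hφw hφs hφD
      hζm hDζm hweak (hgediv b hdiv)
    refine caccioppoli_of_energy hlam (abs_nonneg _) (by positivity) hC hJ hJ0 hp hz hv hvs hf₁
      hp0 hz0 hv0 (Eventually.of_forall hfle) ?_ hf₁n hsob
    filter_upwards [hAb, hell] with x h1 h2
    exact energy_pointwise_left (hζ0 x) (h1.trans (le_abs_self _)) (h2 _)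
  · obtain ⟨hJ, hJ0⟩ := energy_inequality_right (s := sobolevExponent n) hV hb hc hd hφw hφs hφD
      hζm hDζm hweak (hgediv c hdiv)
    refine caccioppoli_of_energy hlam (abs_nonneg _) (by positivity) hC hJ hJ0 hp hz hv hvs hf₁
      hp0 hz0 hv0 (Eventually.of_forall hfle) ?_ hf₁n hsob
    filter_upwards [hAb, hell] with x h1 h2
    exact energy_pointwise_right (hζ0 x) (h1.trans (le_abs_self _)) (h2 _)

/-! ### Decay of the energy away from the pole -/

theorem gradient_pow_apply {n : ℕ} {η : Rn n → ℝ} (hη : ContDiff ℝ ∞ η) (k : ℕ) (x : Rn n) :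
    gradient (fun y => η y ^ k) x = (k * η x ^ (k - 1)) • gradient η x := by
  unfold gradient
  rw [fderiv_fun_pow k (hη.differentiable (by simp)).differentiableAt]
  simp [map_smul]

/-- This is why the cut-off is `η^n`: its gradient loses one power of `η`, and what remains still
dominates the power needed for interpolation, because `n (2 - 4/(n+2)) ≤ 2 (n - 1)`. -/
theorem pow_mul_sq_le_interpolation {n : ℕ} (hn : 3 ≤ n) {η y : ℝ} (hη : 0 ≤ η) (hη1 : η ≤ 1)
    (hy : 0 ≤ y) : (η ^ (n - 1) * y) ^ 2 ≤
      |η ^ n * y| ^ (2 - 4 / ((n : ℝ) + 2)) * y ^ (4 / ((n : ℝ) + 2)) := by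
  have hn' : (3 : ℝ) ≤ n := by exact_mod_cast hn
  rcases hy.eq_or_lt with rfl | hy
  · simp only [mul_zero, ne_eq, OfNat.ofNat_ne_zero, not_false_eq_true, zero_pow]
    positivity
  rcases hη.eq_or_lt with rfl | hη
  · rw [zero_pow (by omega)]
    simp only [zero_mul, ne_eq, OfNat.ofNat_ne_zero, not_false_eq_true, zero_pow]
    positivity
  rw [abs_of_pos (by positivity), Real.mul_rpow (by positivity) hy.le, mul_assoc,
    ← Real.rpow_add hy, sub_add_cancel, mul_pow, ← pow_mul]
  have e : y ^ (2 : ℝ) = y ^ 2 := by norm_cast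
  rw [e]
  refine mul_le_mul_of_nonneg_right ?_ (by positivity)
  rw [← Real.rpow_natCast, ← Real.rpow_natCast, ← Real.rpow_mul hη.le]
  refine Real.rpow_le_rpow_of_exponent_ge hη hη1 ?_
  push_cast [Nat.cast_sub (show 1 ≤ n by omega)]
  rw [mul_sub, mul_div_assoc', sub_le_iff_le_add, ← sub_le_iff_le_add', le_div_iff₀ (by linarith)]
  nlinarith

/-- The volume of the unit ball of `ℝⁿ`. -/
noncomputable def unitBallVolume (n : ℕ) : ℝ := (volume (Metric.ball (0 : Rn n) 1)).toReal

theorem volume_closedBall_eq {n : ℕ} (x : Rn n) {r : ℝ} (hr : 0 ≤ r) :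
    volume (Metric.closedBall x r) = ENNReal.ofReal (unitBallVolume n * r ^ n) := by
  rw [Measure.addHaar_closedBall _ _ hr, unitBallVolume, mul_comm, ENNReal.ofReal_mul
    ENNReal.toReal_nonneg, ENNReal.ofReal_toReal measure_ball_lt_top.ne]
  simp

theorem lintegral_ball_le_of_weakLpNorm_le {n : ℕ} (hn : 3 ≤ n) {U E : Set (Rn n)} {N r : ℝ}
    {f : Rn n → ℝ} {x₀ : Rn n} (hr : 0 < r) (hN : 0 < N) (hEU : E ⊆ U)
    (hE : E ⊆ Metric.closedBall x₀ (2 * r)) (hf : AEStronglyMeasurable f (volume.restrict U))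
    (h : weakLpNorm U ((n : ℝ) / ((n : ℝ) - 2)) f ≤ ENNReal.ofReal N) :
    ∫⁻ x in E, ‖f x‖ₑ ≤ ENNReal.ofReal ((unitBallVolume n * 2 ^ n + n) * (N * r ^ 2)) := by
  have hn' : (3 : ℝ) ≤ n := by exact_mod_cast hn
  have h2 : (0 : ℝ) < n - 2 := by linarith
  have hω : 0 ≤ unitBallVolume n := ENNReal.toReal_nonneg
  have hp : 1 < (n : ℝ) / (n - 2) := by rw [lt_div_iff₀ h2]; linarith
  -- The height `N r^(2-n)`, the size of the model solution at distance `r`, makes both parts of the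
  -- layer cake of order `N r²`.
  refine (lintegral_le_of_weakLpNorm_le hp (τ := N * r ^ (2 - (n : ℝ))) (by positivity) hN.le
    (by positivity) hEU ((measure_mono hE).trans
      (volume_closedBall_eq x₀ (by positivity : (0 : ℝ) ≤ 2 * r)).le) hf h).trans ?_
  refine ENNReal.ofReal_le_ofReal ?_
  have e1 : r ^ (2 - (n : ℝ)) * r ^ n = r ^ 2 := by
    rw [← Real.rpow_natCast r n, ← Real.rpow_add hr, sub_add_cancel]
    norm_cast
  have e2 : N ^ ((n : ℝ) / (n - 2)) * (N * r ^ (2 - (n : ℝ))) ^ (1 - (n : ℝ) / (n - 2)) =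
      N * r ^ 2 := by
    rw [Real.mul_rpow hN.le (by positivity), ← mul_assoc, ← Real.rpow_add hN, ← Real.rpow_mul hr.le]
    have e3 : (2 - (n : ℝ)) * (1 - n / (n - 2)) = (2 : ℕ) := by
      field_simp
      push_cast
      ring
    rw [add_sub_cancel, Real.rpow_one, e3, Real.rpow_natCast]
  have e4 : (n : ℝ) / (n - 2) - 1 = 2 / (n - 2) := by
    field_simp
    ring
  rw [mul_div_assoc', e2, e4, mul_pow]
  have e5 : N * r ^ 2 / (2 / ((n : ℝ) - 2)) ≤ n * (N * r ^ 2) := by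
    rw [div_div_eq_mul_div, div_le_iff₀ (by norm_num)]
    have : 0 ≤ N * r ^ 2 := by positivity
    nlinarith
  have e6 : N * r ^ (2 - (n : ℝ)) * (unitBallVolume n * (2 ^ n * r ^ n)) =
      unitBallVolume n * 2 ^ n * (N * r ^ 2) := by
    rw [← e1]; ring
  rw [e6]
  linarith

theorem lintegral_le_of_weakLpNorm_le_of_volume {n : ℕ} (hn : 3 ≤ n) {U E : Set (Rn n)} {N V : ℝ}
    {f : Rn n → ℝ} (hN : 0 < N) (hEU : E ⊆ U) (hV : volume U ≤ ENNReal.ofReal V)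
    (hf : AEStronglyMeasurable f (volume.restrict U))
    (h : weakLpNorm U ((n : ℝ) / ((n : ℝ) - 2)) f ≤ ENNReal.ofReal N) :
    ∫⁻ x in E, ‖f x‖ₑ ≤ ENNReal.ofReal ((|V| + n) * N) := by
  have hn' : (3 : ℝ) ≤ n := by exact_mod_cast hn
  have h2 : (0 : ℝ) < n - 2 := by linarith
  have hp : 1 < (n : ℝ) / (n - 2) := by rw [lt_div_iff₀ h2]; linarith
  refine (lintegral_le_of_weakLpNorm_le hp hN hN.le (abs_nonneg V) hEU ((measure_mono hEU).trans
    (hV.trans (ENNReal.ofReal_le_ofReal (le_abs_self V)))) hf h).trans ?_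
  refine ENNReal.ofReal_le_ofReal ?_
  have e4 : (n : ℝ) / (n - 2) - 1 = 2 / (n - 2) := by
    field_simp
    ring
  rw [mul_div_assoc', ← Real.rpow_add hN, add_sub_cancel, Real.rpow_one, e4]
  have e5 : N / (2 / ((n : ℝ) - 2)) ≤ n * N := by
    rw [div_div_eq_mul_div, div_le_iff₀ (by norm_num)]
    nlinarith
  linarith

theorem sq_le_of_interpolated_bounds {n : ℕ} (hn : 3 ≤ n) {N r m K c a P Z W S : ℝ} (hN : 0 < N)
    (hr : 0 < r) (hr1 : r ≤ 1) (hm0 : 0 ≤ m) (hK : 0 ≤ K)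
    (hS0 : 0 ≤ S) (hP : P ^ 2 ≤ K * (Z ^ 2 + W ^ 2)) (hS : S ≤ c * (P + Z))
    (hZ : Z ^ 2 ≤ (a / r) ^ 2 *
      (S ^ (2 - 4 / ((n : ℝ) + 2)) * (m * (N * r ^ 2)) ^ (4 / ((n : ℝ) + 2))))
    (hW : W ^ 2 ≤ 1 * (S ^ (2 - 4 / ((n : ℝ) + 2)) * (m * N) ^ (4 / ((n : ℝ) + 2)))) :
    P ^ 2 ≤ K * ((a ^ 2 + 1) * m ^ (4 / ((n : ℝ) + 2)) *
      (2 * c ^ 2 * (K + 1)) ^ ((n : ℝ) / (n + 2))) ^ (((n : ℝ) + 2) / 2) *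
        (N ^ 2 * r ^ (2 - (n : ℝ))) := by
  have hn' : (3 : ℝ) ≤ n := by exact_mod_cast hn
  -- `R` is chosen so that `r⁻² (N r²)^σ = R^σ` and `R² = N² r^(2-n)`. The bound for `W` lacks the
  -- factor `r⁻²`, but `N ≤ R` since `r ≤ 1`.
  set R := N * r ^ ((2 - (n : ℝ)) / 2) with hR
  have hR0 : 0 ≤ R := by positivity
  set σ := 4 / ((n : ℝ) + 2) with hσ
  have hσ0 : 0 < σ := by positivity
  set B := (a ^ 2 + 1) * m ^ σ with hB
  set K₂ := 2 * c ^ 2 * (K + 1) with hK₂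
  have hRσ : r⁻¹ ^ 2 * (N * r ^ 2) ^ σ = R ^ σ := by
    rw [hR, Real.mul_rpow hN.le (by positivity), Real.mul_rpow hN.le (by positivity),
      ← Real.rpow_natCast r 2, ← Real.rpow_mul hr.le, ← Real.rpow_mul hr.le, inv_pow,
      ← Real.rpow_natCast r 2, ← Real.rpow_neg hr.le, mul_left_comm, ← Real.rpow_add hr]
    congr 2
    rw [hσ]
    push_cast
    field_simp
    ring
  have hNR : N ^ σ ≤ R ^ σ := by
    refine Real.rpow_le_rpow hN.le ?_ hσ0.le
    refine le_mul_of_one_le_right hN.le ?_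
    exact Real.one_le_rpow_of_pos_of_le_one_of_nonpos hr hr1 (by linarith)
  have hSp : 0 ≤ S ^ (2 - σ) := Real.rpow_nonneg hS0 _
  have hQ : Z ^ 2 + W ^ 2 ≤ B * (S ^ (2 - σ) * R ^ σ) := by
    have hZ' : (a / r) ^ 2 * (S ^ (2 - σ) * (m * (N * r ^ 2)) ^ σ) =
        a ^ 2 * m ^ σ * (S ^ (2 - σ) * R ^ σ) := by
      rw [← hRσ, Real.mul_rpow hm0 (by positivity)]
      ring
    have hW' : 1 * (S ^ (2 - σ) * (m * N) ^ σ) ≤ m ^ σ * (S ^ (2 - σ) * R ^ σ) := by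
      rw [Real.mul_rpow hm0 hN.le, one_mul, mul_left_comm]
      gcongr
    rw [hB]
    linarith
  have hSQ : S ^ 2 ≤ K₂ * (Z ^ 2 + W ^ 2) := by
    have h1 : S ^ 2 ≤ (c * (P + Z)) ^ 2 := pow_le_pow_left₀ hS0 hS 2
    have h2 : (P + Z) ^ 2 ≤ 2 * (P ^ 2 + Z ^ 2) := by nlinarith [sq_nonneg (P - Z)]
    have h3 : P ^ 2 + Z ^ 2 ≤ (K + 1) * (Z ^ 2 + W ^ 2) := by nlinarith [sq_nonneg W]
    calc S ^ 2 ≤ c ^ 2 * (P + Z) ^ 2 := by rwa [mul_pow] at h1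
      _ ≤ c ^ 2 * (2 * ((K + 1) * (Z ^ 2 + W ^ 2))) := by gcongr; linarith
      _ = _ := by rw [hK₂]; ring
  have hfin := le_of_interpolation hn (by positivity : 0 ≤ Z ^ 2 + W ^ 2) hS0
    (by positivity : 0 ≤ K₂) (by positivity : 0 ≤ B) hR0 hSQ hQ
  have hR2 : R ^ 2 = N ^ 2 * r ^ (2 - (n : ℝ)) := by
    rw [hR, mul_pow, ← Real.rpow_natCast (r ^ _), ← Real.rpow_mul hr.le]
    push_cast
    rw [div_mul_cancel₀ _ (by norm_num)]
  rw [← hR2, mul_assoc]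
  exact hP.trans (mul_le_mul_of_nonneg_left hfin hK)

theorem exists_energy_decay {n : ℕ} (hn : 3 ≤ n) {lam : ℝ} (Lam ρ V : ℝ) (hlam : 0 < lam) :
    ∃ C : ℝ, 0 ≤ C ∧ ∀ (Ω : Set (Rn n)) (A : Rn n → Rn n →L[ℝ] Rn n) (b c : Rn n → Rn n)
      (d : Rn n → ℝ) (x₀ : Rn n) (u : Rn n → ℝ) (Du : Rn n → Rn n),
      IsOpen Ω → volume Ω ≤ ENNReal.ofReal V → AEStronglyMeasurable A (volume.restrict Ω) →
      (∀ᵐ x ∂(volume.restrict Ω), ‖A x‖ ≤ Lam) →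
      (∀ᵐ x ∂(volume.restrict Ω), ∀ ξ : Rn n, lam * ‖ξ‖ ^ 2 ≤ inner ℝ (A x ξ) ξ) →
      MemLp b (n : ℝ≥0∞) (volume.restrict Ω) → MemLp c (n : ℝ≥0∞) (volume.restrict Ω) →
      MemLp d ((n : ℝ≥0∞) / 2) (volume.restrict Ω) → (GeDiv Ω d b ∨ GeDiv Ω d c) →
      tailLevel Ω (fun x => b x - c x) (lam / (3 * sobolevConst n)) ≤ ρ →
      AEStronglyMeasurable u (volume.restrict Ω) →
      (∀ s : ℝ, 0 < s → MemW1p (Ω \ Metric.closedBall x₀ s) 2 u Du) →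
      VanishesOnBoundaryAwayFrom Ω x₀ u → IsWeakSolution (Ω \ {x₀}) A b c d u Du →
      ∀ N r : ℝ, 0 < N → 0 < r → r ≤ 1 →
      weakLpNorm Ω ((n : ℝ) / ((n : ℝ) - 2)) u ≤ ENNReal.ofReal N →
      eLpNorm Du 2 (volume.restrict (Ω \ Metric.closedBall x₀ (2 * r))) ^ (2 : ℝ) ≤
        ENNReal.ofReal (C * (N ^ 2 * r ^ (2 - (n : ℝ)))) := by
  have hn' : (3 : ℝ) ≤ n := by exact_mod_cast hn
  have hCn := sobolevConst_pos hn
  have hω : 0 ≤ unitBallVolume n := ENNReal.toReal_nonneg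
  obtain ⟨κ, hκ, hcut⟩ := exists_cutoff n
  set K := caccioppoliConst lam |Lam| (|ρ| + 1) with hKdef
  have hK : 0 ≤ K := caccioppoliConst_nonneg _ hlam (by positivity)
  -- A single constant for both `L¹` bounds of `u`: on the annulus, by `m N r²`, and on all of `Ω`
  -- outside the ball, by `m N`.
  set m := unitBallVolume n * 2 ^ n + |V| + n with hm
  have hm0 : 0 ≤ m := by positivity
  set σ := 4 / ((n : ℝ) + 2) with hσ
  have hσ0 : 0 < σ := by positivity
  set B := ((n * κ) ^ 2 + 1) * m ^ σ with hB
  set K₂ := 2 * sobolevConst n ^ 2 * (K + 1) with hK₂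
  refine ⟨K * (B * K₂ ^ ((n : ℝ) / (n + 2))) ^ (((n : ℝ) + 2) / 2), by positivity, ?_⟩
  intro Ω A b c d x₀ u Du hΩ hV hA hAb hell hb hc hd hdiv hρ hum hW1 hvan hsol N r hN hr hr1 hweak
  set μ := volume.restrict Ω with hμ
  obtain ⟨w, Dw, hw, hwu⟩ := hvan r hr
  obtain ⟨φ, hφ, hφw, hφD, hφs⟩ := hw.exists_approx hn hΩ
  obtain ⟨η, hη, hη0, hη1, hηr, hη2r, hηκ, hη2r'⟩ := hcut x₀ r hr
  have hopen : IsOpen (Ω \ Metric.closedBall x₀ r) := hΩ.sdiff Metric.isClosed_closedBall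
  have hDwu := (hW1 r hr).2.2.ae_eq hΩ hopen Set.sdiff_subset hw.1.2.2 hwu
  have hwu' : ∀ᵐ x ∂μ, x ∉ Metric.closedBall x₀ r → w x = u x ∧ Dw x = Du x := by
    rw [ae_restrict_iff' hopen.measurableSet] at hwu hDwu
    rw [hμ, ae_restrict_iff' hΩ.measurableSet]
    filter_upwards [hwu, hDwu] with x h1 h2 hx hxr
    exact ⟨h1 ⟨hx, hxr⟩, h2 ⟨hx, hxr⟩⟩
  have hζ : ContDiff ℝ ∞ fun x => η x ^ n := hη.pow n
  have hζg : ∀ x, ‖gradient (fun y => η y ^ n) x‖ ≤ n * κ / r * η x ^ (n - 1) := fun x => by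
    rw [gradient_pow_apply hη, norm_smul, Real.norm_of_nonneg
      (mul_nonneg (Nat.cast_nonneg _) (pow_nonneg (hη0 x) _))]
    calc n * η x ^ (n - 1) * ‖gradient η x‖ ≤ n * η x ^ (n - 1) * (κ / r) :=
          mul_le_mul_of_nonneg_left (hηκ x)
            (mul_nonneg (Nat.cast_nonneg _) (pow_nonneg (hη0 x) _))
      _ = _ := by ring
  have hζr : ∀ x ∈ Metric.closedBall x₀ r, η x ^ n = 0 := fun x hx => by
    rw [hηr x hx, zero_pow (by omega)]
  obtain ⟨hP, hS⟩ := caccioppoli hn hlam hΩ hA hAb hell hb hc hd hdiv hρ hsol hr hφ hφw hφD hφs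
    hwu' hζ (fun x => pow_nonneg (hη0 x) n) (fun x => pow_le_one₀ (hη0 x) (hη1 x))
    (κ := n * κ / r) (fun x => (hζg x).trans
      (mul_le_of_le_one_right (by positivity) (pow_le_one₀ (hη0 x) (hη1 x)))) hζr
  rw [← hμ, ← hKdef] at hP
  rw [← hμ] at hS
  have hζm : MemLp (fun x => η x ^ n) ⊤ μ :=
    memLp_top_of_bound hζ.continuous.aestronglyMeasurable 1 (Eventually.of_forall fun x => by
      rw [Real.norm_of_nonneg (pow_nonneg (hη0 x) n)]; exact pow_le_one₀ (hη0 x) (hη1 x))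
  have hvs : MemLp (fun x => η x ^ n * |w x|) (sobolevExponent n) μ :=
    hφs.memLp_lim.norm.mul' (p := ⊤) (r := sobolevExponent n) hζm
  have hp : MemLp (fun x => η x ^ n * ‖Dw x‖) 2 μ :=
    hφD.memLp_lim.norm.mul' (p := ⊤) (r := 2) hζm
  have hL : ∀ E : Set (Rn n), MeasurableSet E → Disjoint E (Metric.closedBall x₀ r) →
      ∫⁻ x in E, ‖w x‖ₑ ∂μ = ∫⁻ x in E ∩ Ω, ‖u x‖ₑ := fun E hE hEd => by
    rw [hμ, Measure.restrict_restrict hE]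
    refine lintegral_congr_ae ?_
    have h1 : ∀ᵐ x ∂volume.restrict (E ∩ Ω), w x = u x :=
      ae_restrict_of_ae_restrict_of_subset
        (show E ∩ Ω ⊆ Ω \ Metric.closedBall x₀ r from
          fun x hx => ⟨hx.2, Set.disjoint_left.1 hEd hx.1⟩) hwu
    filter_upwards [h1] with x hx
    rw [hx]
  set P := (eLpNorm (fun x => η x ^ n * ‖Dw x‖) 2 μ).toReal with hPdef
  set Z := (eLpNorm (fun x => |w x| * ‖gradient (fun y => η y ^ n) x‖) 2 μ).toReal with hZdef
  set W := (eLpNorm (fun x => η x ^ n * |w x|) 2 μ).toReal with hWdef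
  set S := (eLpNorm (fun x => η x ^ n * |w x|) (sobolevExponent n) μ).toReal with hSdef
  have hP0 : 0 ≤ P := ENNReal.toReal_nonneg
  have hS0 : 0 ≤ S := ENNReal.toReal_nonneg
  have hZ : Z ^ 2 ≤ (n * κ / r) ^ 2 * (S ^ (2 - σ) * (m * (N * r ^ 2)) ^ σ) := by
    refine sq_eLpNorm_le_interpolation hn
      (E := Metric.closedBall x₀ (2 * r) \ Metric.closedBall x₀ r) (w := w)
      (Metric.isClosed_closedBall.measurableSet.diff Metric.isClosed_closedBall.measurableSet)
      hvs hφw.memLp_lim.1 (by positivity) (by positivity) ?_ ?_ ?_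
    · rw [hL _ (Metric.isClosed_closedBall.measurableSet.diff
        Metric.isClosed_closedBall.measurableSet) Set.disjoint_sdiff_left]
      refine (lintegral_ball_le_of_weakLpNorm_le hn hr hN Set.inter_subset_right
        (fun x hx => hx.1.1) hum hweak).trans (ENNReal.ofReal_le_ofReal ?_)
      refine mul_le_mul_of_nonneg_right ?_ (by positivity)
      rw [hm]
      linarith [abs_nonneg V]
    · intro x hx
      have : gradient (fun y => η y ^ n) x = 0 := by
        rw [gradient_pow_apply hη]
        by_cases h2 : x ∈ Metric.closedBall x₀ (2 * r)
        · have h1 : x ∈ Metric.closedBall x₀ r := by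
            by_contra h1
            exact hx ⟨h2, h1⟩
          rw [hηr x h1, zero_pow (by omega), mul_zero, zero_smul]
        · rw [hη2r' x h2, smul_zero]
      rw [this, norm_zero, mul_zero]
    · intro x
      refine le_trans ?_ (mul_le_mul_of_nonneg_left
        (pow_mul_sq_le_interpolation hn (hη0 x) (hη1 x) (abs_nonneg (w x))) (by positivity))
      rw [← mul_pow]
      refine pow_le_pow_left₀ (by positivity) ?_ 2
      calc |w x| * ‖gradient (fun y => η y ^ n) x‖ ≤ |w x| * (n * κ / r * η x ^ (n - 1)) :=
            mul_le_mul_of_nonneg_left (hζg x) (abs_nonneg _)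
        _ = _ := by ring
  have hW : W ^ 2 ≤ 1 * (S ^ (2 - σ) * (m * N) ^ σ) := by
    refine sq_eLpNorm_le_interpolation hn
      (E := (Metric.closedBall x₀ r)ᶜ) (w := w)
      Metric.isClosed_closedBall.measurableSet.compl
      hvs hφw.memLp_lim.1 (by positivity) (by positivity) ?_ ?_ ?_
    · rw [hL _ Metric.isClosed_closedBall.measurableSet.compl disjoint_compl_left]
      refine (lintegral_le_of_weakLpNorm_le_of_volume hn hN Set.inter_subset_right
        hV hum hweak).trans (ENNReal.ofReal_le_ofReal ?_)
      refine mul_le_mul_of_nonneg_right ?_ hN.le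
      rw [hm]
      have : 0 ≤ unitBallVolume n * 2 ^ n := by positivity
      linarith
    · intro x hx
      rw [hζr x (not_not.1 hx), zero_mul]
    · intro x
      rw [one_mul]
      refine le_trans ?_ (pow_mul_sq_le_interpolation hn (hη0 x) (hη1 x) (abs_nonneg (w x)))
      have := hη0 x
      refine pow_le_pow_left₀ (by positivity) ?_ 2
      exact mul_le_mul_of_nonneg_right (pow_le_pow_of_le_one (hη0 x) (hη1 x) (Nat.sub_le n 1))
        (abs_nonneg _)
  have hPfin := sq_le_of_interpolated_bounds hn hN hr hr1 hm0 hK hS0 hP hS hZ hW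
  have hDu : eLpNorm Du 2 (volume.restrict (Ω \ Metric.closedBall x₀ (2 * r))) ≤
      ENNReal.ofReal P := by
    rw [hPdef, ENNReal.ofReal_toReal hp.2.ne]
    have h1 : eLpNorm Du 2 (volume.restrict (Ω \ Metric.closedBall x₀ (2 * r))) =
        eLpNorm (fun x => η x ^ n * ‖Dw x‖) 2
          (volume.restrict (Ω \ Metric.closedBall x₀ (2 * r))) := by
      refine eLpNorm_congr_norm_ae ?_
      have h2 := ae_restrict_of_ae_restrict_of_subset
        (Set.sdiff_subset : Ω \ Metric.closedBall x₀ (2 * r) ⊆ Ω) hwu'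
      filter_upwards [h2, ae_restrict_mem
        (hΩ.measurableSet.diff Metric.isClosed_closedBall.measurableSet)] with x hx hxm
      rw [hη2r x hxm.2, one_pow, one_mul, norm_norm,
        (hx fun h => hxm.2 (Metric.closedBall_subset_closedBall (by linarith) h)).2]
    rw [h1]
    exact eLpNorm_mono_measure _ (Measure.restrict_mono Set.sdiff_subset le_rfl)
  refine (ENNReal.rpow_le_rpow hDu (by norm_num)).trans ?_
  rw [ENNReal.ofReal_rpow_of_nonneg hP0 (by norm_num)]
  refine ENNReal.ofReal_le_ofReal ?_
  rw [Real.rpow_two]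
  exact hPfin

/-! ### From energy decay to the weak-type estimate of the gradient. -/

theorem measure_lt_le_of_energy_decay {n : ℕ} {Ω : Set (Rn n)} {x₀ : Rn n} {Du : Rn n → Rn n} {C N s r : ℝ} (hC : 0 ≤ C)
    (hs : 0 < s) (hr : 0 < r) (hsr : N = s * r ^ ((n : ℝ) - 1))
    (hm : AEStronglyMeasurable Du (volume.restrict (Ω \ Metric.closedBall x₀ (2 * r))))
    (hE : eLpNorm Du 2 (volume.restrict (Ω \ Metric.closedBall x₀ (2 * r))) ^ (2 : ℝ) ≤
      ENNReal.ofReal (C * (N ^ 2 * r ^ (2 - (n : ℝ))))) :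
    volume.restrict Ω {x | ENNReal.ofReal s < ‖Du x‖ₑ} ≤
      ENNReal.ofReal ((unitBallVolume n * 2 ^ n + C) * r ^ n) := by
  have hω : 0 ≤ unitBallVolume n := ENNReal.toReal_nonneg
  have h1 : volume.restrict (Ω \ Metric.closedBall x₀ (2 * r)) {x | ENNReal.ofReal s < ‖Du x‖ₑ} ≤
      ENNReal.ofReal (C * r ^ n) := by
    have h2 := mul_meas_ge_le_pow_eLpNorm' (volume.restrict (Ω \ Metric.closedBall x₀ (2 * r)))
      (p := 2) (by norm_num) (by norm_num) hm (ENNReal.ofReal s)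
    simp only [ENNReal.toReal_ofNat] at h2
    have h3 := h2.trans hE
    rw [mul_comm, ← ENNReal.le_div_iff_mul_le (by simp [hs]) (by simp)] at h3
    have h4 : {x | ENNReal.ofReal s < ‖Du x‖ₑ} ⊆ {x | ENNReal.ofReal s ≤ ‖Du x‖ₑ} := fun x hx =>
      le_of_lt (show ENNReal.ofReal s < ‖Du x‖ₑ from hx)
    refine (measure_mono h4).trans (h3.trans (le_of_eq ?_))
    rw [ENNReal.ofReal_rpow_of_nonneg hs.le (by norm_num),
      ← ENNReal.ofReal_div_of_pos (by positivity)]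
    congr 1
    -- With `N = s r^(n-1)`, Chebyshev's bound `C N² r^(2-n) / s²` becomes `C r^n`, comparable to
    -- the volume of the excluded ball.
    have e : (r ^ ((n : ℝ) - 1)) ^ 2 * r ^ (2 - (n : ℝ)) = r ^ n := by
      rw [← Real.rpow_natCast _ 2, ← Real.rpow_mul hr.le, ← Real.rpow_add hr,
        ← Real.rpow_natCast r n]
      congr 1
      push_cast
      ring
    rw [hsr, ← e, Real.rpow_two]
    field_simp
  have hsub : Ω ⊆ Metric.closedBall x₀ (2 * r) ∪ (Ω \ Metric.closedBall x₀ (2 * r)) := by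
    rw [Set.union_sdiff_self]
    exact Set.subset_union_right
  calc volume.restrict Ω {x | ENNReal.ofReal s < ‖Du x‖ₑ}
      ≤ volume.restrict (Metric.closedBall x₀ (2 * r) ∪ (Ω \ Metric.closedBall x₀ (2 * r)))
          {x | ENNReal.ofReal s < ‖Du x‖ₑ} := Measure.restrict_mono hsub le_rfl _
    _ ≤ volume.restrict (Metric.closedBall x₀ (2 * r)) {x | ENNReal.ofReal s < ‖Du x‖ₑ} +
          volume.restrict (Ω \ Metric.closedBall x₀ (2 * r)) {x | ENNReal.ofReal s < ‖Du x‖ₑ} :=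
        Measure.restrict_union_le _ _ _
    _ ≤ ENNReal.ofReal (unitBallVolume n * (2 * r) ^ n) + ENNReal.ofReal (C * r ^ n) := by
        gcongr
        refine (measure_mono (Set.subset_univ _)).trans ?_
        rw [Measure.restrict_apply_univ, volume_closedBall_eq x₀ (by positivity)]
    _ = _ := by
        rw [← ENNReal.ofReal_add (by positivity) (by positivity)]
        congr 1
        ring

theorem mainTheorem9 (n : ℕ) (hn : 3 ≤ n) (lam Lam ρ V : ℝ) (hlam : 0 < lam) :
    ∃ C : ℝ≥0,
      ∀ (Ω : Set (Rn n)) (A : Rn n → Rn n →L[ℝ] Rn n) (b c : Rn n → Rn n) (d : Rn n → ℝ)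
        (x₀ : Rn n) (q : ℝ) (u : Rn n → ℝ) (Du : Rn n → Rn n),
        IsOpen Ω → IsConnected Ω → volume Ω ≤ ENNReal.ofReal V →
        AEStronglyMeasurable A (volume.restrict Ω) →
        (∀ᵐ x ∂(volume.restrict Ω), ‖A x‖ ≤ Lam) →
        (∀ᵐ x ∂(volume.restrict Ω), ∀ ξ : Rn n, lam * ‖ξ‖ ^ 2 ≤ inner ℝ (A x ξ) ξ) →
        MemLp b (n : ℝ≥0∞) (volume.restrict Ω) →
        MemLp c (n : ℝ≥0∞) (volume.restrict Ω) →
        MemLp d ((n : ℝ≥0∞) / 2) (volume.restrict Ω) →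
        (GeDiv Ω d b ∨ GeDiv Ω d c) →
        tailLevel Ω (fun x => b x - c x) (lam / (3 * sobolevConst n)) ≤ ρ →
        x₀ ∈ Ω →
        1 ≤ q → q < (n : ℝ) / ((n : ℝ) - 1) →
        MemW01p Ω (ENNReal.ofReal q) u Du →
        (∀ s : ℝ, 0 < s → MemW1p (Ω \ Metric.closedBall x₀ s) 2 u Du) →
        VanishesOnBoundaryAwayFrom Ω x₀ u →
        IsWeakSolution (Ω \ {x₀}) A b c d u Du →
        weakLpNorm Ω ((n : ℝ) / ((n : ℝ) - 2)) u < ⊤ →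
        weakLpNorm Ω ((n : ℝ) / ((n : ℝ) - 1)) Du ≤
          (C : ℝ≥0∞) * weakLpNorm Ω ((n : ℝ) / ((n : ℝ) - 2)) u ^ 2 + (C : ℝ≥0∞) := by
  have hn' : (3 : ℝ) ≤ n := by exact_mod_cast hn
  have hn1 : (0 : ℝ) < n - 1 := by linarith
  have hω : 0 ≤ unitBallVolume n := ENNReal.toReal_nonneg
  obtain ⟨C, hC, hdecay⟩ := exists_energy_decay hn Lam ρ V hlam
  set θ := 1 / ((n : ℝ) / (n - 1)) with hθ
  have hθ0 : 0 < θ := by positivity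
  set D := unitBallVolume n * 2 ^ n + C with hD
  have hD0 : 0 ≤ D := by positivity
  set C' := D ^ θ + |V| ^ θ with hC'
  have hC'0 : 0 ≤ C' := by positivity
  refine ⟨(2 * C').toNNReal, ?_⟩
  intro Ω A b c d x₀ q u Du hΩ _ hV hA hAb hell hb hc hd hdiv hρ _ _ _ hu0 hW1 hvan hsol hfin
  set M := (weakLpNorm Ω ((n : ℝ) / ((n : ℝ) - 2)) u).toReal with hM
  have hMe : weakLpNorm Ω ((n : ℝ) / ((n : ℝ) - 2)) u = ENNReal.ofReal M :=
    (ENNReal.ofReal_toReal hfin.ne).symm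
  have hM0 : 0 ≤ M := ENNReal.toReal_nonneg
  -- The decay estimate needs a positive bound, so `N = M + 1` also covers a vanishing norm.
  have hN : 0 < M + 1 := by linarith
  have hbound : weakLpNorm Ω ((n : ℝ) / ((n : ℝ) - 1)) Du ≤ ENNReal.ofReal (C' * (M + 1)) := by
    refine iSup_le fun t => ?_
    rw [← hθ]
    -- Below the height `M + 1` the volume of `Ω` suffices; above it the radius chosen below is at
    -- most one, as the decay estimate requires.
    rcases lt_or_ge (t : ℝ) (M + 1) with ht | ht
    · calc (t : ℝ≥0∞) * (volume.restrict Ω {x | (t : ℝ≥0∞) < ‖Du x‖ₑ}) ^ θ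
          ≤ ENNReal.ofReal (M + 1) * (ENNReal.ofReal |V|) ^ θ := by
            gcongr
            · rw [← ENNReal.ofReal_coe_nnreal]
              exact ENNReal.ofReal_le_ofReal ht.le
            · refine (measure_mono (Set.subset_univ _)).trans ?_
              rw [Measure.restrict_apply_univ]
              exact hV.trans (ENNReal.ofReal_le_ofReal (le_abs_self V))
        _ = ENNReal.ofReal ((M + 1) * |V| ^ θ) := by
            rw [ENNReal.ofReal_rpow_of_nonneg (abs_nonneg V) hθ0.le, ← ENNReal.ofReal_mul hN.le]
        _ ≤ _ := by
            refine ENNReal.ofReal_le_ofReal ?_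
            rw [mul_comm]
            gcongr
            exact le_add_of_nonneg_left (by positivity)
    · have ht0 : 0 < (t : ℝ) := hN.trans_le ht
      set r := ((M + 1) / t) ^ (1 / ((n : ℝ) - 1)) with hr
      have hr0 : 0 < r := by positivity
      have hr1 : r ≤ 1 :=
        Real.rpow_le_one (by positivity) ((div_le_one ht0).2 ht) (by positivity)
      have hrt : M + 1 = t * r ^ ((n : ℝ) - 1) := by
        rw [hr, ← Real.rpow_mul (by positivity), one_div_mul_cancel hn1.ne', Real.rpow_one]
        field_simp
      have hE := hdecay Ω A b c d x₀ u Du hΩ hV hA hAb hell hb hc hd hdiv hρ hu0.1.1.1 hW1 hvan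
        hsol (M + 1) r hN hr0 hr1 (hMe.le.trans (ENNReal.ofReal_le_ofReal (by linarith)))
      have hmeas := measure_lt_le_of_energy_decay hC ht0 hr0 hrt
        (hW1 (2 * r) (by positivity)).2.1.1 hE
      rw [ENNReal.ofReal_coe_nnreal, ← hD] at hmeas
      calc (t : ℝ≥0∞) * (volume.restrict Ω {x | (t : ℝ≥0∞) < ‖Du x‖ₑ}) ^ θ
          ≤ ENNReal.ofReal t * (ENNReal.ofReal (D * r ^ n)) ^ θ := by
            rw [ENNReal.ofReal_coe_nnreal]
            gcongr
        _ = ENNReal.ofReal (D ^ θ * (M + 1)) := by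
            rw [ENNReal.ofReal_rpow_of_nonneg (by positivity) hθ0.le, ← ENNReal.ofReal_mul ht0.le,
              Real.mul_rpow hD0 (by positivity), ← Real.rpow_natCast r n, ← Real.rpow_mul hr0.le, hrt]
            congr 1
            have e : (n : ℝ) * θ = n - 1 := by
              rw [hθ]; field_simp
            rw [e]
            ring
        _ ≤ _ := by
            refine ENNReal.ofReal_le_ofReal ?_
            gcongr
            exact le_add_of_nonneg_right (by positivity)
  refine hbound.trans ?_
  rw [hMe, ← ENNReal.ofReal_pow hM0]
  change _ ≤ ENNReal.ofReal (2 * C') * _ + ENNReal.ofReal (2 * C')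
  rw [← ENNReal.ofReal_mul (by positivity), ← ENNReal.ofReal_add (by positivity) (by positivity)]
  refine ENNReal.ofReal_le_ofReal ?_
  -- The bound obtained is linear, `C' (M + 1)`; the quadratic form follows from `2M ≤ M² + 1`.
  nlinarith [mul_nonneg hC'0 (sq_nonneg (M - 1)), mul_nonneg hC'0 (sq_nonneg M)]
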